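/- **Networks.** A network $\mathsf A=(\mathcal S,\mathcal G,\mathcal T,\mathcal E,\beta)$ is a finite directed acyclic hypergraph whose nodes are partitioned into sources $\mathcal S$, intermediate nodes $\mathcal G$ and sinks $\mathcal T$. Each hyperedge $e\in\mathcal E$ has a tail $\mathrm{Tl}(e)\in\mathcal S\cup\mathcal G$ and a set of heads $\mathrm{Hd}(e)\subseteq\mathcal G\cup\mathcal T$ (hyperedges are labelled, so parallel ones may occur). Each source has exactly one outgoing hyperedge. Each sink $t$ demands a set $\beta(t)\subseteq\mathcal S$. $\mathrm{In}(v)$, $\mathrm{Out}(v)$ are the sets of incoming and outgoing hyperedges of $v$; $\mathcal E_U$ is the set of hyperedges that do not leave a source; for $s\in\mathcal S$, $\mathrm{Hd}(\mathrm{Out}(s))$ is the set of heads of the hyperedge leaving $s$. **Rate regions.** There is one variable $U_e$ for each $e\in\mathcal E$, and $Y_s:=U_e$ if $\mathrm{Out}(s)=\{e\}$; $N=|\mathcal E|$. For a set $\Gamma$ of functions $h:2^{\mathcal E}\to\mathbb R$, let $\mathcal R_\Gamma(\mathsf A)$ be the set of $(\mathbf r,\boldsymbol\omega)\in\mathbb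 R^{\mathcal E_U}\times\mathbb R^{\mathcal S}$ for which some $h\in\Gamma$ satisfies: $h(Y_{\mathcal S})=\sum_{s\in\mathcal S} h(Y_s)$; $h(\mathrm{Out}(g)\cup\mathrm{In}(g))=h(\mathrm{In}(g))$ for all $g\in\mathcal G$; $h(U_e)\le r_e$ for all $e\in\mathcal E_U$; $h(Y_{\beta(t)}\cup \mathrm{In}(t))=h(\mathrm{In}(t))$ for all $t\in\mathcal T$; and $\omega_s=h(Y_s)$ for all $s\in\mathcal S$. Put $\mathcal R_*(\mathsf A)$, $\mathcal R_o(\mathsf A)$, $\mathcal R_q(\mathsf A)$, $\mathcal R_{s,q}(\mathsf A)$ for $\Gamma$ equal, respectively, to: the conic hull of the entropic vectors $\Gamma_N^*$ (joint entropies of $N$ finitely valued random variables); the cone $\Gamma_N$ of polymatroid rank functions (with $h(\emptyset)=0$, monotone, submodular); the conic hull of the rank functions of families of $N$ subspaces of finite-dimensional $\mathbb F_q$-vector spaces; the conic hull of the rank functions of families of $N$ vectors over $\mathbb F_q$. One says that $\mathbb F_q$ vector linear codes suffice, that $\mathbb F_q$ scalar linear codes suffice, or that the Shannon outer bound is tight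 for $\mathsf A$, if $\mathcal R_q(\mathsf A)=\mathcal R_*(\mathsf A)$, $\mathcal R_{s,q}(\mathsf A)=\mathcal R_*(\mathsf A)$, or $\mathcal R_o(\mathsf A)=\mathcal R_*(\mathsf A)$, respectively. **Minimality reduction.** Deleting a node means that it is removed, also from all heads, with its outgoing hyperedges and (for a source) all demands for it. The following conditions are checked in the given order; at the first one that is violated, one violation is repaired as indicated, and the check restarts from the beginning, until all hold. The result (for any choices made) is called a minimal form of the network. 0. Each sink $t$ has $\beta(t)\ne\emptyset$; else delete $t$. 1. Each source $s$ has $\mathrm{Hd}(\mathrm{Out}(s))\cap\mathcal G\neq\emptyset$; else delete $s$. 2. If $t\in\mathcal T\cap\mathrm{Hd}(\mathrm{Out}(s))$ then $s\notin\beta(t)$; else remove $s$ from $\beta(t)$. 3. $\mathrm{In}(g),\mathrm{Out}(g),\mathrm{In}(t)$ are nonempty for all $g\in\mathcal G$, $t\in\mathcal T$; else delete $g$, respectively $t$ and all sources in $\beta(t)$. 4. $\mathrm{In}(k)\ne\mathrm{In}(j)$ for $k\neq j$ in $\mathcal G$; else merge $j$ into $k$ (the outputs of $j$ become outputs of $k$).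 5. Each source is demanded by a sink; else delete it. 6. Two different sources $s,s'$ do not have both the same $\mathrm{Hd}(\mathrm{Out}(\cdot))$ and the same set of demanding sinks; else merge them (delete $s'$). 7. $\mathrm{Hd}(e)\ne\emptyset$ for all $e$; else delete $e$. 8. No $e\ne e'$ have the same tail and the same heads; else delete $e'$. 9. There are no $e,e'\in\mathcal E$, $g\in\mathcal G$ with $\mathrm{In}(g)=\{e\}$, $\mathrm{Hd}(e)=\{g\}$, $\mathrm{Out}(g)=\{e'\}$; else remove $g$ and replace $e,e'$ by one hyperedge from $\mathrm{Tl}(e)$ to $\mathrm{Hd}(e')$. 10. There is a directed path from each $s\in\beta(t)$ to $t$, for each $t\in\mathcal T$; else delete $s$. 11. $\mathrm{In}(t)\neq\mathrm{In}(t')$ for sinks $t\ne t'$; else merge them, with demand $\beta(t)\cup\beta(t')$. 12. If $t\neq t'$ are sinks with $\mathrm{In}(t)\subseteq\mathrm{In}(t')$ then $\beta(t)\cap\beta(t')=\emptyset$; else remove $\beta(t)\cap\beta(t')$ from $\beta(t')$. 13. If $\mathrm{In}(t)\subseteq\mathrm{In}(t')$ for sinks $t,t'$ and $s\in\beta(t)$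 then $t'\notin\mathrm{Hd}(\mathrm{Out}(s))$; else remove $t'$ from $\mathrm{Hd}(\mathrm{Out}(s))$. 14. The network is weakly connected; else pass to any one of its weakly connected components. **Minors.** $\mathsf A'$ is a minor of $\mathsf A$ ($\mathsf A'\prec\mathsf A$) if it is obtained from $\mathsf A$ by a finite sequence of operations, each of which deletes a source, deletes a hyperedge $e\in\mathcal E_U$, or contracts a hyperedge $e\in\mathcal E_U$ (that is, removes $e$ and replaces $\mathrm{Hd}(e')$ by $\mathrm{Hd}(e')\cup\mathrm{Hd}(e)$ for each $e'\in\mathrm{In}(\mathrm{Tl}(e))$), and then passes to a minimal form of the result. **Statement.** Let $\mathsf A$ be a network, $\mathsf A'\prec\mathsf A$ and $\mathbb F_q$ a finite field. If $\mathbb F_q$ vector linear codes suffice for $\mathsf A$, they suffice for $\mathsf A'$; if $\mathbb F_q$ scalar linear codes suffice for $\mathsf A$, they suffice for $\mathsf A'$; if the Shannon outer bound is tight for $\mathsf A$, it is tight for $\mathsf A'$. That is, for each $l\in\{q,(s,q),o\}$, $\mathcal R_l(\mathsf A)=\mathcal R_*(\mathsf A)$ implies $\mathcal R_l(\mathsf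 A')=\mathcal R_*(\mathsf A')$. Equivalently, for each of these three properties, if $\mathsf A'$ lacks it then $\mathsf A$ lacks it. -/

import Mathlib

/-! ### Cones of set functions on a finite ground set -/

/-- The Shannon outer bound `Γ_N`: rank functions of polymatroids on the ground set `ι`. -/
def shannonCone (ι : Type*) [DecidableEq ι] : Set (Finset ι → ℝ) :=
  {h | h ∅ = 0 ∧ (∀ X Y : Finset ι, X ⊆ Y → h X ≤ h Y) ∧
    ∀ X Y : Finset ι, h (X ∪ Y) + h (X ∩ Y) ≤ h X + h Y}

/-- Shannon entropy (in nats) of a function `Y` on a finite probability space with mass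
function `p`. -/
noncomputable def finEntropy {Ω α : Type*} [Fintype Ω] [DecidableEq α]
    (p : Ω → ℝ) (Y : Ω → α) : ℝ :=
  ∑ y ∈ Finset.univ.image Y, Real.negMulLog (∑ w with Y w = y, p w)

/-- The set `Γ*_N` of entropic vectors: joint entropies of finitely valued random variables
`(U i)`, indexed by `ι`, on a common probability space. -/
def entropicVectors (ι : Type*) : Set (Finset ι → ℝ) :=
  {h | ∃ (Ω : Type) (_ : Fintype Ω) (p : Ω → ℝ) (U : ι → Ω → ℕ),
    (∀ w, 0 ≤ p w) ∧ ∑ w, p w = 1 ∧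
    ∀ X : Finset ι, h X = finEntropy p (fun w (i : X) => U i w)}

/-- Rank functions of matroids on `ι` that are representable over `F` (by one vector per
element): the scalar linear codes. -/
def scalarRanks (F : Type*) [Field F] (ι : Type*) : Set (Finset ι → ℝ) :=
  {h | ∃ (n : ℕ) (v : ι → Fin n → F),
    ∀ X : Finset ι, h X = (Module.finrank F (Submodule.span F (v '' (X : Set ι))) : ℝ)}

/-- Rank functions of subspace arrangements over `F` (one subspace per element): the vector
linear codes of arbitrary dimension. -/
def vectorRanks (F : Type*) [Field F] (ι : Type*) : Set (Finset ι → ℝ) :=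
  {h | ∃ (n : ℕ) (W : ι → Submodule F (Fin n → F)),
    ∀ X : Finset ι, h X = (Module.finrank F (⨆ i ∈ X, W i : Submodule F (Fin n → F)) : ℝ)}

/-- The conic hull: all finite combinations with nonnegative coefficients. -/
def conicHull {M : Type*} [AddCommMonoid M] [Module ℝ M] (s : Set M) : Set M :=
  (PointedCone.hull ℝ s : Set M)

/-! ### Networks -/

/-- The data of a hyperedge network coding problem, with nodes labelled in `V` and hyperedges
labelled in `E`.  Hyperedge `e` goes from `tail e` to the set of nodes `head e`; sink `t`
demands the sources in `demand t`.  The values of `tail`, `head`, `demand` at labels that are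
not in use are irrelevant. -/
structure Network (V E : Type*) where
  sources : Finset V
  nodes : Finset V
  sinks : Finset V
  edges : Finset E
  tail : E → V
  head : E → Finset V
  demand : V → Finset V

namespace Network

section Basic

variable {V E : Type*} [DecidableEq V] [DecidableEq E] (A : Network V E)

/-- All nodes: sources, intermediate nodes and sinks. -/
def verts : Finset V := A.sources ∪ A.nodes ∪ A.sinks

/-- The incoming hyperedges of a node. -/
def inEdges (v : V) : Finset E := A.edges.filter (fun e => v ∈ A.head e)

/-- The outgoing hyperedges of a node. -/
def outEdges (v : V) : Finset E := A.edges.filter (fun e => A.tail e = v)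

/-- The outgoing hyperedges of a set of nodes. -/
def outEdgesOf (D : Finset V) : Finset E := A.edges.filter (fun e => A.tail e ∈ D)

/-- The nodes directly reached from `v`: `Hd(Out(v))`. -/
def succs (v : V) : Finset V := (A.outEdges v).biUnion A.head

/-- The sinks which demand source `s`. -/
def demanders (s : V) : Finset V := A.sinks.filter (fun t => s ∈ A.demand t)

/-- Some hyperedge leads from `u` to `v`. -/
def Step (u v : V) : Prop := ∃ e ∈ A.edges, A.tail e = u ∧ v ∈ A.head e

/-- There is a directed path from `u` to `v`. -/
def Path (u v : V) : Prop := Relation.ReflTransGen A.Step u v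

/-- There is a path from `u` to `v` that ignores directions. -/
def WeakPath (u v : V) : Prop :=
  Relation.ReflTransGen (fun a b => A.Step a b ∨ A.Step b a) u v

/-- The data form a directed acyclic hypergraph whose nodes are partitioned into sources,
intermediate nodes and sinks, where each source has exactly one outgoing hyperedge and no
incoming one, sinks have no outgoing hyperedge, and sinks demand sources. -/
structure IsNetwork : Prop where
  disjoint_sources_nodes : Disjoint A.sources A.nodes
  disjoint_sources_sinks : Disjoint A.sources A.sinks
  disjoint_nodes_sinks : Disjoint A.nodes A.sinks
  tail_mem : ∀ e ∈ A.edges, A.tail e ∈ A.sources ∪ A.nodes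
  head_subset : ∀ e ∈ A.edges, A.head e ⊆ A.nodes ∪ A.sinks
  source_edge : ∀ s ∈ A.sources, ∃! e, e ∈ A.edges ∧ A.tail e = s
  demand_subset : ∀ t ∈ A.sinks, A.demand t ⊆ A.sources
  acyclic : ∀ v, ¬ Relation.TransGen A.Step v v

/-! ### Rate regions -/

/-- The random variables of the network: one per hyperedge.  The variable of the outgoing
hyperedge of a source is the source variable. -/
abbrev Var : Type _ := {e : E // e ∈ A.edges}

/-- The hyperedges that do not leave a source; they carry rate constraints. -/
abbrev CodedEdge : Type _ := {e : E // e ∈ A.edges ∧ A.tail e ∉ A.sources}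

/-- The sources. -/
abbrev Source : Type _ := {s : V // s ∈ A.sources}

/-- A set of hyperedges, as a set of variables. -/
def vars (X : Finset E) : Finset A.Var := X.subtype (· ∈ A.edges)

/-- The joint entropy of the sources is the sum of their entropies. -/
def SourceIndependence (h : Finset A.Var → ℝ) : Prop :=
  h (A.vars (A.outEdgesOf A.sources)) = ∑ s ∈ A.sources, h (A.vars (A.outEdges s))

/-- At each intermediate node, the outputs are functions of the inputs. -/
def NodeCoding (h : Finset A.Var → ℝ) : Prop :=
  ∀ g ∈ A.nodes, h (A.vars (A.outEdges g) ∪ A.vars (A.inEdges g)) = h (A.vars (A.inEdges g))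

/-- The entropies of the coded hyperedges respect the rates. -/
def RateConstraint (h : Finset A.Var → ℝ) (r : A.CodedEdge → ℝ) : Prop :=
  ∀ e : A.CodedEdge, h {⟨e.1, e.2.1⟩} ≤ r e

/-- At each sink, the demanded sources are functions of the inputs. -/
def SinkDecoding (h : Finset A.Var → ℝ) : Prop :=
  ∀ t ∈ A.sinks, h (A.vars (A.outEdgesOf (A.demand t)) ∪ A.vars (A.inEdges t)) =
    h (A.vars (A.inEdges t))

/-- The projection to the edge rates `r` and the source entropies `ω` of the intersection of
`Γ` with all constraints of the network. -/
def region (Γ : Set (Finset A.Var → ℝ)) : Set ((A.CodedEdge → ℝ) × (A.Source → ℝ)) :=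
  {x | ∃ h ∈ Γ, A.SourceIndependence h ∧ A.NodeCoding h ∧ A.RateConstraint h x.1 ∧
    A.SinkDecoding h ∧ ∀ s : A.Source, x.2 s = h (A.vars (A.outEdges s.1))}

/-- The region `R_*`, built from the conic hull of the entropic vectors. -/
def entropicRegion : Set ((A.CodedEdge → ℝ) × (A.Source → ℝ)) :=
  A.region (conicHull (entropicVectors A.Var))

/-- The Shannon outer bound `R_o`. -/
def shannonRegion : Set ((A.CodedEdge → ℝ) × (A.Source → ℝ)) :=
  A.region (shannonCone A.Var)

/-- The region `R_q` of vector linear codes over the finite field `F`. -/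
def vectorRegion (F : Type*) [Field F] : Set ((A.CodedEdge → ℝ) × (A.Source → ℝ)) :=
  A.region (conicHull (vectorRanks F A.Var))

/-- The region `R_{s,q}` of scalar linear codes over the finite field `F`. -/
def scalarRegion (F : Type*) [Field F] : Set ((A.CodedEdge → ℝ) × (A.Source → ℝ)) :=
  A.region (conicHull (scalarRanks F A.Var))

/-- Vector linear codes over `F` suffice. -/
def VectorCodesSuffice (F : Type*) [Field F] : Prop := A.vectorRegion F = A.entropicRegion

/-- Scalar linear codes over `F` suffice. -/
def ScalarCodesSuffice (F : Type*) [Field F] : Prop := A.scalarRegion F = A.entropicRegion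

/-- The Shannon outer bound is tight. -/
def ShannonTight : Prop := A.shannonRegion = A.entropicRegion

/-! ### Elementary modifications -/

/-- Delete the sources in `D`, with their outgoing hyperedges and all demands for them. -/
def deleteSources (D : Finset V) : Network V E :=
  { A with
    sources := A.sources \ D
    edges := A.edges.filter (fun e => A.tail e ∉ D)
    demand := fun t => A.demand t \ D }

/-- Delete one hyperedge. -/
def deleteEdge (e : E) : Network V E := { A with edges := A.edges.erase e }

/-- Contract the hyperedge `e`: it disappears, and every input of its tail gets the heads of
`e` as additional heads. -/
def contractEdge (e : E) : Network V E :=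
  { A with
    edges := A.edges.erase e
    head := fun e' => if A.tail e ∈ A.head e' then A.head e' ∪ A.head e else A.head e' }

/-- Delete an intermediate node, with its outgoing hyperedges. -/
def deleteNode (g : V) : Network V E :=
  { A with
    nodes := A.nodes.erase g
    edges := A.edges.filter (fun e => A.tail e ≠ g)
    head := fun e => (A.head e).erase g }

/-- Delete a sink. -/
def deleteSink (t : V) : Network V E :=
  { A with
    sinks := A.sinks.erase t
    head := fun e => (A.head e).erase t }

/-- Sink `t` no longer demands the sources in `D`. -/
def dropDemand (t : V) (D : Finset V) : Network V E :=
  { A with demand := Function.update A.demand t (A.demand t \ D) }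

/-- Merge the intermediate node `j` into the intermediate node `k` (which has the same
inputs): the outputs of `j` become outputs of `k`. -/
def mergeNodes (k j : V) : Network V E :=
  { A with
    nodes := A.nodes.erase j
    tail := fun e => if A.tail e = j then k else A.tail e
    head := fun e => (A.head e).erase j }

/-- Merge the sink `t'` into the sink `t` (which has the same inputs). -/
def mergeSinks (t t' : V) : Network V E :=
  { A with
    sinks := A.sinks.erase t'
    head := fun e => (A.head e).erase t'
    demand := Function.update A.demand t (A.demand t ∪ A.demand t') }

/-- Remove the intermediate node `g` with only input `e` and only output `e'`, and replace
`e, e'` by one hyperedge (still labelled `e`) from the tail of `e` to the heads of `e'`. -/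
def bypassNode (g : V) (e e' : E) : Network V E :=
  { A with
    nodes := A.nodes.erase g
    edges := A.edges.erase e'
    head := Function.update A.head e (A.head e') }

/-- Sink `t` loses its direct access to source `s`. -/
def dropAccess (s t : V) : Network V E :=
  { A with head := fun e => if A.tail e = s then (A.head e).erase t else A.head e }

open Classical in
/-- The weakly connected component of `v`. -/
noncomputable def component (v : V) : Network V E :=
  { A with
    sources := A.sources.filter (A.WeakPath v)
    nodes := A.nodes.filter (A.WeakPath v)
    sinks := A.sinks.filter (A.WeakPath v)
    edges := A.edges.filter (fun e => A.WeakPath v (A.tail e))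
    demand := fun t => (A.demand t).filter (A.WeakPath v) }

/-! ### Minimality -/

/-- The minimality conditions, numbered in the order in which they are checked. -/
def MinCond : ℕ → Prop
  -- every sink demands something
  | 0 => ∀ t ∈ A.sinks, (A.demand t).Nonempty
  -- no source is connected only to sinks
  | 1 => ∀ s ∈ A.sources, (A.succs s ∩ A.nodes).Nonempty
  -- no sink demands a source to which it is directly connected
  | 2 => ∀ s ∈ A.sources, ∀ t ∈ A.sinks, t ∈ A.succs s → s ∉ A.demand t
  -- intermediate nodes have inputs and outputs, sinks have inputs
  | 3 => (∀ g ∈ A.nodes, (A.inEdges g).Nonempty ∧ (A.outEdges g).Nonempty) ∧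
      ∀ t ∈ A.sinks, (A.inEdges t).Nonempty
  -- different intermediate nodes have different inputs
  | 4 => ∀ k ∈ A.nodes, ∀ j ∈ A.nodes, A.inEdges k = A.inEdges j → k = j
  -- each source is demanded
  | 5 => ∀ s ∈ A.sources, ∃ t ∈ A.sinks, s ∈ A.demand t
  -- no two sources have the same successors and are demanded by the same sinks
  | 6 => ∀ s ∈ A.sources, ∀ s' ∈ A.sources, A.succs s = A.succs s' →
      A.demanders s = A.demanders s' → s = s'
  -- each hyperedge has a head
  | 7 => ∀ e ∈ A.edges, (A.head e).Nonempty
  -- no parallel hyperedges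
  | 8 => ∀ e ∈ A.edges, ∀ e' ∈ A.edges, A.tail e = A.tail e' → A.head e = A.head e' → e = e'
  -- no intermediate node with one output and one input, the input having no other head
  | 9 => ¬ ∃ e ∈ A.edges, ∃ e' ∈ A.edges, ∃ g ∈ A.nodes,
      A.inEdges g = {e} ∧ A.head e = {g} ∧ A.outEdges g = {e'}
  -- there is a path to each sink from each source that it demands
  | 10 => ∀ t ∈ A.sinks, ∀ s ∈ A.demand t, A.Path s t
  -- different sinks have different inputs
  | 11 => ∀ t ∈ A.sinks, ∀ t' ∈ A.sinks, A.inEdges t = A.inEdges t' → t = t'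
  -- a sink does not demand what another sink decodes from fewer inputs
  | 12 => ∀ t ∈ A.sinks, ∀ t' ∈ A.sinks, t ≠ t' → A.inEdges t ⊆ A.inEdges t' →
      Disjoint (A.demand t) (A.demand t')
  -- a sink has no direct access to what a sink with fewer inputs decodes
  | 13 => ∀ t ∈ A.sinks, ∀ t' ∈ A.sinks, A.inEdges t ⊆ A.inEdges t' →
      ∀ s ∈ A.demand t, t' ∉ A.succs s
  -- weak connectivity
  | 14 => ∀ u ∈ A.verts, ∀ v ∈ A.verts, A.WeakPath u v
  | _ => True

/-- The network is minimal. -/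
def IsMinimal : Prop := ∀ k, A.MinCond k

/-- `A.Reduction k B`: the network `B` arises from `A` by repairing one violation of the
minimality condition number `k`. -/
inductive Reduction : ℕ → Network V E → Prop
  | emptyDemand (t : V) (ht : t ∈ A.sinks) (h : A.demand t = ∅) :
      Reduction 0 (A.deleteSink t)
  | uselessSource (s : V) (hs : s ∈ A.sources) (h : A.succs s ∩ A.nodes = ∅) :
      Reduction 1 (A.deleteSources {s})
  | directDemand (s t : V) (hs : s ∈ A.sources) (ht : t ∈ A.sinks)
      (hst : t ∈ A.succs s) (hd : s ∈ A.demand t) :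
      Reduction 2 (A.dropDemand t {s})
  | uselessNode (g : V) (hg : g ∈ A.nodes) (h : A.inEdges g = ∅ ∨ A.outEdges g = ∅) :
      Reduction 3 (A.deleteNode g)
  | uselessSink (t : V) (ht : t ∈ A.sinks) (h : A.inEdges t = ∅) :
      Reduction 3 ((A.deleteSink t).deleteSources (A.demand t))
  | equalNodes (k j : V) (hk : k ∈ A.nodes) (hj : j ∈ A.nodes) (hkj : k ≠ j)
      (h : A.inEdges k = A.inEdges j) :
      Reduction 4 (A.mergeNodes k j)
  | undemanded (s : V) (hs : s ∈ A.sources) (h : ∀ t ∈ A.sinks, s ∉ A.demand t) :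
      Reduction 5 (A.deleteSources {s})
  | equalSources (s s' : V) (hs : s ∈ A.sources) (hs' : s' ∈ A.sources) (hne : s ≠ s')
      (h : A.succs s = A.succs s') (hd : A.demanders s = A.demanders s') :
      Reduction 6 (A.deleteSources {s'})
  | emptyHead (e : E) (he : e ∈ A.edges) (h : A.head e = ∅) :
      Reduction 7 (A.deleteEdge e)
  | parallelEdges (e e' : E) (he : e ∈ A.edges) (he' : e' ∈ A.edges) (hne : e ≠ e')
      (ht : A.tail e = A.tail e') (hh : A.head e = A.head e') :
      Reduction 8 (A.deleteEdge e')
  | relayNode (e e' : E) (g : V) (he : e ∈ A.edges) (he' : e' ∈ A.edges) (hg : g ∈ A.nodes)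
      (hin : A.inEdges g = {e}) (hh : A.head e = {g}) (hout : A.outEdges g = {e'}) :
      Reduction 9 (A.bypassNode g e e')
  | unreachable (s t : V) (ht : t ∈ A.sinks) (hd : s ∈ A.demand t) (h : ¬ A.Path s t) :
      Reduction 10 (A.deleteSources {s})
  | equalSinks (t t' : V) (ht : t ∈ A.sinks) (ht' : t' ∈ A.sinks) (hne : t ≠ t')
      (h : A.inEdges t = A.inEdges t') :
      Reduction 11 (A.mergeSinks t t')
  | impliedDemand (t t' : V) (ht : t ∈ A.sinks) (ht' : t' ∈ A.sinks) (hne : t ≠ t')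
      (h : A.inEdges t ⊆ A.inEdges t') (hd : ¬ Disjoint (A.demand t) (A.demand t')) :
      Reduction 12 (A.dropDemand t' (A.demand t ∩ A.demand t'))
  | impliedAccess (s t t' : V) (ht : t ∈ A.sinks) (ht' : t' ∈ A.sinks)
      (h : A.inEdges t ⊆ A.inEdges t') (hs : s ∈ A.demand t) (hst : t' ∈ A.succs s) :
      Reduction 13 (A.dropAccess s t')
  | disconnected (v : V) (hv : v ∈ A.verts) (h : ∃ u ∈ A.verts, ¬ A.WeakPath v u) :
      Reduction 14 (A.component v)

/-- One step of the minimality reduction: the first violated condition is repaired. -/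
def ReductionStep (B : Network V E) : Prop :=
  ∃ k, (∀ j < k, A.MinCond j) ∧ A.Reduction k B

end Basic

section Minors

variable {V E : Type*} [DecidableEq V] [DecidableEq E]

/-- `B` is a minimal form of `A`: the result of applying reduction steps until the network is
minimal. -/
def IsMinimalForm (A B : Network V E) : Prop :=
  Relation.ReflTransGen (fun A₁ A₂ : Network V E => A₁.ReductionStep A₂) A B ∧ B.IsMinimal

/-- `B` is a minimal form of a network obtained from `A` by deleting a source, or by deleting
or contracting a hyperedge that does not leave a source. -/
inductive MinorStep (A B : Network V E) : Prop
  | deleteSource (s : V) (hs : s ∈ A.sources) (h : IsMinimalForm (A.deleteSources {s}) B)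
  | deleteEdge (e : E) (he : e ∈ A.edges) (hs : A.tail e ∉ A.sources)
      (h : IsMinimalForm (A.deleteEdge e) B)
  | contractEdge (e : E) (he : e ∈ A.edges) (hs : A.tail e ∉ A.sources)
      (h : IsMinimalForm (A.contractEdge e) B)

/-- `IsMinor A' A`: the network `A'` is embedded in `A`, that is, it arises from `A` by a
finite sequence of source deletions, edge deletions and edge contractions, each followed by
the minimality reduction. -/
def IsMinor (A' A : Network V E) : Prop := Relation.ReflTransGen MinorStep A A'

end Minors

end Network

/-!
The three properties are inherited because realizations of a minor translate into realizations of
the network and back, by a recipe that does not depend on the class of set functions.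

Fix a step from `A` to `B`: a deletion, a contraction, or a repair of the minimality reduction. A
set function `H` that satisfies the constraints of `B` with rates `r` and source entropies `ω` gives
one for `A`, in which every hyperedge of `A` carries the joint variable of some hyperedges of `B`
(none for a deleted hyperedge, all inputs of its tail for a contracted one), with rates and source
entropies `(r', ω')` that are, for instance, zero on the deleted hyperedges. Conversely, each
polymatroid that realizes `(r', ω')` in `A` already satisfies the constraints of `B` with `(r, ω)`.
This is the relation `Network.Simulates`; it is transitive.

Now let `Γ₁ ⊆ Γ₂` be classes of polymatroids that give the same region for `A`, where `Γ₂` is closed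
under forming joint variables. A point of the `Γ₂`-region of `B` yields a point of the `Γ₂`-region
of `A`, hence a realization in `A` from `Γ₁`, and this one realizes the original point of `B`
(`Network.Simulates.achieves_iff`). Scalar codes are not closed under joint variables, but they only
ever play the role of `Γ₁`: the pairs are linear codes inside the conic hull of the entropic vectors,
and this hull inside the Shannon cone. The two inclusions are `conicHull_vectorRanks_subset`
(the restriction of a uniformly random functional to a subspace of dimension `d` has entropy
`d log |F|`) and `entropicVectors_subset_shannonCone` (submodularity of entropy).

That each step is a simulation is shown by three lemmas: `Network.simulates_of_null` for everything
that removes hyperedges, `Network.simulates_of_realizes_iff` for repairs that leave the constraints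
equivalent, and `Network.IsNetwork.simulates_of_contract` for contractions and relay nodes.
-/

/-! ### Polymatroids and functional dependence -/

section Polymatroid

variable {ι κ : Type*} [DecidableEq ι] [DecidableEq κ]

/-- In the polymatroid `H`, the variables in `X` are functions of those in `Y`. -/
def Determines (H : Finset ι → ℝ) (Y X : Finset ι) : Prop := H (X ∪ Y) = H Y

theorem Determines.of_subset {H : Finset ι → ℝ} {X Y : Finset ι} (h : X ⊆ Y) :
    Determines H Y X := by
  rw [Determines, Finset.union_eq_right.2 h]

theorem Determines.mono_left {H : Finset ι → ℝ} (hH : H ∈ shannonCone ι) {X Y Y' : Finset ι}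
    (h : Determines H Y X) (hY : Y ⊆ Y') : Determines H Y' X := by
  obtain ⟨-, hmono, hsub⟩ := hH
  have h1 := hsub (X ∪ Y) Y'
  have h2 : X ∪ Y ∪ Y' = X ∪ Y' := by
    rw [Finset.union_assoc, Finset.union_eq_right.2 hY]
  have h3 := hmono Y ((X ∪ Y) ∩ Y') (Finset.subset_inter Finset.subset_union_right hY)
  have h4 := hmono Y' (X ∪ Y') Finset.subset_union_right
  rw [Determines] at *
  rw [h2] at h1
  linarith

theorem Determines.anti_right {H : Finset ι → ℝ} (hH : H ∈ shannonCone ι) {X X' Y : Finset ι}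
    (h : Determines H Y X) (hX : X' ⊆ X) : Determines H Y X' :=
  le_antisymm ((hH.2.1 _ _ (Finset.union_subset_union_left hX)).trans_eq h)
    (hH.2.1 _ _ Finset.subset_union_right)

theorem Determines.union {H : Finset ι → ℝ} (hH : H ∈ shannonCone ι) {X X' Y : Finset ι}
    (h : Determines H Y X) (h' : Determines H Y X') : Determines H Y (X ∪ X') := by
  have h1 : Determines H (X' ∪ Y) X := h.mono_left hH Finset.subset_union_right
  rw [Determines] at *
  rw [Finset.union_assoc, h1, h']

theorem Determines.trans {H : Finset ι → ℝ} (hH : H ∈ shannonCone ι) {X Y Z : Finset ι}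
    (h : Determines H Z Y) (h' : Determines H Y X) : Determines H Z X := by
  have h1 : Determines H (Y ∪ Z) X := h'.mono_left hH Finset.subset_union_left
  refine Determines.anti_right hH (X := X ∪ Y) ?_ Finset.subset_union_left
  rw [Determines] at *
  rw [Finset.union_assoc, h1, h]

theorem Determines.of_forall {H : Finset ι → ℝ} (hH : H ∈ shannonCone ι) {X Y : Finset ι}
    (h : ∀ x ∈ X, Determines H Y {x}) : Determines H Y X := by
  induction X using Finset.induction_on with
  | empty => exact Determines.of_subset (Finset.empty_subset _)
  | insert a s ha ih =>
    rw [Finset.insert_eq]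
    exact (h a (Finset.mem_insert_self _ _)).union hH
      (ih fun x hx => h x (Finset.mem_insert_of_mem hx))

theorem Determines.of_nonpos {H : Finset ι → ℝ} (hH : H ∈ shannonCone ι) {X Y : Finset ι}
    (h : H X ≤ 0) : Determines H Y X := by
  refine Determines.mono_left hH (Y := ∅) ?_ (Finset.empty_subset _)
  rw [Determines, Finset.union_empty, hH.1]
  exact le_antisymm h (hH.1 ▸ hH.2.1 ∅ X (Finset.empty_subset _))

/-- Sets that determine each other have the same rank. -/
theorem Determines.eq {H : Finset ι → ℝ} {X Y : Finset ι}
    (h : Determines H Y X) (h' : Determines H X Y) : H X = H Y := by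
  rw [Determines] at *
  rw [← h, ← h', Finset.union_comm]

/-- The set function on `κ` obtained by replacing each element `k` by the set `φ k` of elements
of the ground set `ι`: the new variable `k` is the joint variable of all variables in `φ k`. -/
def pullback (φ : κ → Finset ι) (H : Finset ι → ℝ) : Finset κ → ℝ := fun X => H (X.biUnion φ)

theorem pullback_id (H : Finset ι → ℝ) : pullback (fun i => {i}) H = H := by
  funext X
  rw [pullback, Finset.biUnion_singleton_eq_self]

theorem pullback_pullback {μ : Type*} (φ : κ → Finset ι) (ψ : μ → Finset κ)
    (H : Finset ι → ℝ) :
    pullback ψ (pullback φ H) = pullback (fun m => (ψ m).biUnion φ) H := by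
  funext X
  rw [pullback, pullback, pullback, Finset.biUnion_biUnion]

theorem pullback_mem_shannonCone (φ : κ → Finset ι) {H : Finset ι → ℝ}
    (hH : H ∈ shannonCone ι) : pullback φ H ∈ shannonCone κ := by
  obtain ⟨h0, hmono, hsub⟩ := hH
  refine ⟨by simpa [pullback] using h0, fun X Y hXY => ?_, fun X Y => ?_⟩
  · exact hmono _ _ (Finset.biUnion_subset_biUnion_of_subset_left _ hXY)
  · have h1 : (X ∩ Y).biUnion φ ⊆ X.biUnion φ ∩ Y.biUnion φ :=
      Finset.subset_inter
        (Finset.biUnion_subset_biUnion_of_subset_left _ Finset.inter_subset_left)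
        (Finset.biUnion_subset_biUnion_of_subset_left _ Finset.inter_subset_right)
    have h2 := hsub (X.biUnion φ) (Y.biUnion φ)
    have h3 := hmono _ _ h1
    simp only [pullback, Finset.union_biUnion]
    linarith

end Polymatroid

/-! ### Conic hulls -/

theorem conicHull_subset_shannonCone {ι : Type*} [DecidableEq ι] {s : Set (Finset ι → ℝ)}
    (hs : s ⊆ shannonCone ι) : conicHull s ⊆ shannonCone ι := by
  let C : PointedCone ℝ (Finset ι → ℝ) :=
    { carrier := shannonCone ι
      zero_mem' := ⟨rfl, fun _ _ _ => le_rfl, fun _ _ => by simp⟩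
      add_mem' := by
        rintro f g ⟨f0, f1, f2⟩ ⟨g0, g1, g2⟩
        refine ⟨by simp [f0, g0], fun X Y h => add_le_add (f1 X Y h) (g1 X Y h), fun X Y => ?_⟩
        have := f2 X Y
        have := g2 X Y
        simp only [Pi.add_apply]
        linarith
      smul_mem' := by
        rintro ⟨c, hc⟩ f ⟨f0, f1, f2⟩
        refine ⟨?_, fun X Y h => ?_, fun X Y => ?_⟩
        · change c * f ∅ = 0
          rw [f0, mul_zero]
        · exact mul_le_mul_of_nonneg_left (f1 X Y h) hc
        · change c * f _ + c * f _ ≤ c * f _ + c * f _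
          rw [← mul_add, ← mul_add]
          exact mul_le_mul_of_nonneg_left (f2 X Y) hc }
  have h : PointedCone.hull ℝ s ≤ C := Submodule.span_le.2 hs
  exact h

/-- Since `pullback φ` is linear, it maps conic hulls to conic hulls. -/
theorem pullback_mem_conicHull {ι κ : Type*} [DecidableEq ι] (φ : κ → Finset ι)
    {s : Set (Finset ι → ℝ)} {t : Set (Finset κ → ℝ)} (hst : ∀ h ∈ s, pullback φ h ∈ t)
    {h : Finset ι → ℝ} (hh : h ∈ conicHull s) : pullback φ h ∈ conicHull t := by
  change h ∈ Submodule.span _ s at hh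
  change pullback φ h ∈ Submodule.span _ t
  induction hh using Submodule.span_induction with
  | mem x hx => exact Submodule.subset_span (hst x hx)
  | zero => exact Submodule.zero_mem _
  | add x y _ _ hx hy => exact Submodule.add_mem _ hx hy
  | smul c x _ hx => exact Submodule.smul_mem _ c hx

theorem conicHull_subset_of_smul_mem {M : Type*} [AddCommMonoid M] [Module ℝ M] {s t : Set M}
    {c : ℝ} (hc : 0 < c) (h : ∀ x ∈ s, c • x ∈ t) : conicHull s ⊆ conicHull t := by
  refine Submodule.span_le.2 fun x hx => ?_
  have h1 := Submodule.smul_mem (PointedCone.hull ℝ t) (⟨c⁻¹, (inv_pos.2 hc).le⟩ : {c : ℝ // 0 ≤ c})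
    (Submodule.subset_span (h x hx))
  have h2 : (⟨c⁻¹, (inv_pos.2 hc).le⟩ : {c : ℝ // 0 ≤ c}) • (c • x) = x := by
    change c⁻¹ • c • x = x
    rw [smul_smul, inv_mul_cancel₀ hc.ne', one_smul]
  rwa [h2] at h1

/-! ### Shannon entropy -/

section Entropy

variable {Ω : Type*} [Fintype Ω] {α β γ δ : Type*} [DecidableEq α] [DecidableEq β]
  [DecidableEq γ] [DecidableEq δ]

/-- The probability of the event that `Y` takes the same value as at the outcome `w`. -/
def fiberMass (p : Ω → ℝ) (Y : Ω → α) (w : Ω) : ℝ := ∑ w' with Y w' = Y w, p w'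

theorem finEntropy_eq_sum (p : Ω → ℝ) (Y : Ω → α) :
    finEntropy p Y = ∑ w, p w * -Real.log (fiberMass p Y w) := by
  rw [← Finset.sum_fiberwise_of_maps_to (s := Finset.univ) (t := Finset.univ.image Y) (g := Y)
    fun w _ => Finset.mem_image_of_mem _ (Finset.mem_univ w)]
  refine Finset.sum_congr rfl fun y _ => ?_
  rw [Real.negMulLog, neg_mul, ← mul_neg, Finset.sum_mul]
  refine Finset.sum_congr rfl fun w hw => ?_
  rw [fiberMass, (Finset.mem_filter.1 hw).2]

theorem le_fiberMass {p : Ω → ℝ} (hp : ∀ w, 0 ≤ p w) (Y : Ω → α) (w : Ω) :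
    p w ≤ fiberMass p Y w :=
  Finset.single_le_sum (f := p) (fun w' _ => hp w') (by simp)

theorem fiberMass_nonneg {p : Ω → ℝ} (hp : ∀ w, 0 ≤ p w) (Y : Ω → α) (w : Ω) :
    0 ≤ fiberMass p Y w :=
  (hp w).trans (le_fiberMass hp Y w)

/-- Entropy depends only on the partition of the probability space into level sets. -/
theorem finEntropy_congr (p : Ω → ℝ) {Y : Ω → α} {Z : Ω → β}
    (h : ∀ w w', Y w = Y w' ↔ Z w = Z w') : finEntropy p Y = finEntropy p Z := by
  rw [finEntropy_eq_sum, finEntropy_eq_sum]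
  refine Finset.sum_congr rfl fun w _ => ?_
  simp only [fiberMass, h]

theorem finEntropy_mono {p : Ω → ℝ} (hp : ∀ w, 0 ≤ p w) {Y : Ω → α} {Z : Ω → β}
    (h : ∀ w w', Z w = Z w' → Y w = Y w') : finEntropy p Y ≤ finEntropy p Z := by
  rw [finEntropy_eq_sum, finEntropy_eq_sum]
  refine Finset.sum_le_sum fun w _ => ?_
  rcases (hp w).eq_or_lt with h0 | h0
  · rw [← h0, zero_mul, zero_mul]
  · refine mul_le_mul_of_nonneg_left (neg_le_neg (Real.log_le_log ?_ ?_)) h0.le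
    · exact h0.trans_le (le_fiberMass hp Z w)
    · refine Finset.sum_le_sum_of_subset_of_nonneg (fun w' hw' => ?_) fun w' _ _ => hp w'
      simp only [Finset.mem_filter, Finset.mem_univ, true_and] at hw' ⊢
      exact h _ _ hw'

theorem finEntropy_eq_zero {p : Ω → ℝ} (hp : ∑ w, p w = 1) {Y : Ω → α}
    (h : ∀ w w', Y w = Y w') : finEntropy p Y = 0 := by
  rw [finEntropy_eq_sum]
  refine Finset.sum_eq_zero fun w _ => ?_
  rw [fiberMass, Finset.filter_true_of_mem fun w' _ => h w' w, hp, Real.log_one, neg_zero,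
    mul_zero]

/-- If `Y` is a function of `Z₁` and of `Z₂`, and `T` carries the same information as the pair
`(Z₁, Z₂)`, then the "distribution" that makes `Z₁` and `Z₂` conditionally independent given `Y`
has total mass at most one on the support of `T`. -/
theorem sum_mul_fiberMass_div_le_one {p : Ω → ℝ} (hp : ∀ w, 0 ≤ p w) (hp1 : ∑ w, p w = 1)
    {Y : Ω → α} {Z₁ : Ω → β} {Z₂ : Ω → γ} {T : Ω → δ}
    (h₁ : ∀ w w', Z₁ w = Z₁ w' → Y w = Y w') (h₂ : ∀ w w', Z₂ w = Z₂ w' → Y w = Y w')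
    (hT : ∀ w w', T w = T w' ↔ Z₁ w = Z₁ w' ∧ Z₂ w = Z₂ w') :
    ∑ w, p w * (fiberMass p Z₁ w * fiberMass p Z₂ w / (fiberMass p Y w * fiberMass p T w)) ≤ 1 := by
  -- The fibre of `T` over the values `Z₁ u` and `Z₂ v` contributes at most `1 / P(Y = Y u)`.
  have key : ∀ u v, ∑ w, (if Z₁ u = Z₁ w ∧ Z₂ v = Z₂ w then
      p w / (fiberMass p Y w * fiberMass p T w) else 0) ≤
      if Y v = Y u then (fiberMass p Y u)⁻¹ else 0 := by
    intro u v
    by_cases hex : ∃ w, Z₁ u = Z₁ w ∧ Z₂ v = Z₂ w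
    · obtain ⟨w₀, hu, hv⟩ := hex
      have hYu : Y u = Y w₀ := h₁ _ _ hu
      have hYv : Y v = Y w₀ := h₂ _ _ hv
      have h3 : ∀ w, (Z₁ u = Z₁ w ∧ Z₂ v = Z₂ w) ↔ T w = T w₀ := by
        intro w
        rw [hT, hu, hv]
        exact and_congr eq_comm eq_comm
      rw [if_pos (hYv.trans hYu.symm)]
      simp only [h3]
      rw [← Finset.sum_filter]
      have h4 : ∑ w with T w = T w₀, p w / (fiberMass p Y w * fiberMass p T w) =
          ∑ w with T w = T w₀, p w / (fiberMass p Y u * fiberMass p T w₀) := by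
        refine Finset.sum_congr rfl fun w hw => ?_
        have hw' : T w = T w₀ := (Finset.mem_filter.1 hw).2
        have hY' : Y w = Y u := (h₁ _ _ ((hT _ _).1 hw').1).trans hYu.symm
        simp only [fiberMass, hw', hY']
      rw [h4, ← Finset.sum_div]
      change fiberMass p T w₀ / _ ≤ _
      rw [mul_comm, ← div_div, ← one_div]
      exact div_le_div_of_nonneg_right (div_self_le_one _) (fiberMass_nonneg hp Y u)
    · push Not at hex
      rw [Finset.sum_eq_zero fun w _ => if_neg fun h => hex w h.1 h.2]
      split_ifs
      · exact inv_nonneg.2 (fiberMass_nonneg hp Y u)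
      · exact le_rfl
  calc ∑ w, p w * (fiberMass p Z₁ w * fiberMass p Z₂ w / (fiberMass p Y w * fiberMass p T w))
      = ∑ w, ∑ u, ∑ v, p u * p v * (if Z₁ u = Z₁ w ∧ Z₂ v = Z₂ w then
          p w / (fiberMass p Y w * fiberMass p T w) else 0) := by
        refine Finset.sum_congr rfl fun w _ => ?_
        have h5 : fiberMass p Z₁ w * fiberMass p Z₂ w =
            ∑ u, ∑ v, if Z₁ u = Z₁ w ∧ Z₂ v = Z₂ w then p u * p v else 0 := by
          rw [fiberMass, fiberMass, Finset.sum_filter, Finset.sum_filter, Finset.sum_mul_sum]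
          refine Finset.sum_congr rfl fun u _ => Finset.sum_congr rfl fun v _ => ?_
          rw [ite_and]
          split_ifs <;> simp
        rw [h5, ← mul_div_assoc, mul_div_right_comm, Finset.mul_sum]
        refine Finset.sum_congr rfl fun u _ => ?_
        rw [Finset.mul_sum]
        refine Finset.sum_congr rfl fun v _ => ?_
        split_ifs
        · ring
        · ring
    _ = ∑ u, ∑ v, p u * p v * ∑ w, (if Z₁ u = Z₁ w ∧ Z₂ v = Z₂ w then
          p w / (fiberMass p Y w * fiberMass p T w) else 0) := by
        rw [Finset.sum_comm]
        refine Finset.sum_congr rfl fun u _ => ?_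
        rw [Finset.sum_comm]
        refine Finset.sum_congr rfl fun v _ => ?_
        rw [Finset.mul_sum]
    _ ≤ ∑ u, ∑ v, p u * p v * if Y v = Y u then (fiberMass p Y u)⁻¹ else 0 :=
        Finset.sum_le_sum fun u _ => Finset.sum_le_sum fun v _ =>
          mul_le_mul_of_nonneg_left (key u v) (mul_nonneg (hp u) (hp v))
    _ = ∑ u, p u * (fiberMass p Y u / fiberMass p Y u) := by
        refine Finset.sum_congr rfl fun u _ => ?_
        rw [div_eq_mul_inv]
        nth_rw 2 [fiberMass]
        rw [Finset.sum_filter, Finset.sum_mul, Finset.mul_sum]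
        refine Finset.sum_congr rfl fun v _ => ?_
        split_ifs <;> ring
    _ ≤ ∑ u, p u * 1 :=
        Finset.sum_le_sum fun u _ => mul_le_mul_of_nonneg_left (div_self_le_one _) (hp u)
    _ = 1 := by simpa using hp1

/-- Submodularity of entropy: the conditional mutual information of `Z₁` and `Z₂` given `Y` is
nonnegative. -/
theorem finEntropy_submodular {p : Ω → ℝ} (hp : ∀ w, 0 ≤ p w) (hp1 : ∑ w, p w = 1)
    {Y : Ω → α} {Z₁ : Ω → β} {Z₂ : Ω → γ} {T : Ω → δ}
    (h₁ : ∀ w w', Z₁ w = Z₁ w' → Y w = Y w') (h₂ : ∀ w w', Z₂ w = Z₂ w' → Y w = Y w')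
    (hT : ∀ w w', T w = T w' ↔ Z₁ w = Z₁ w' ∧ Z₂ w = Z₂ w') :
    finEntropy p T + finEntropy p Y ≤ finEntropy p Z₁ + finEntropy p Z₂ := by
  have h := sum_mul_fiberMass_div_le_one hp hp1 h₁ h₂ hT
  have key : ∀ w, p w * -Real.log (fiberMass p T w) + p w * -Real.log (fiberMass p Y w) -
      (p w * -Real.log (fiberMass p Z₁ w) + p w * -Real.log (fiberMass p Z₂ w)) ≤
      p w * (fiberMass p Z₁ w * fiberMass p Z₂ w / (fiberMass p Y w * fiberMass p T w)) - p w := by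
    intro w
    rcases (hp w).eq_or_lt with h0 | h0
    · simp [← h0]
    · have p1 := h0.trans_le (le_fiberMass hp Z₁ w)
      have p2 := h0.trans_le (le_fiberMass hp Z₂ w)
      have p3 := h0.trans_le (le_fiberMass hp Y w)
      have p4 := h0.trans_le (le_fiberMass hp T w)
      have h6 := mul_le_mul_of_nonneg_left (Real.log_le_sub_one_of_pos
        (div_pos (mul_pos p1 p2) (mul_pos p3 p4))) h0.le
      rw [Real.log_div (mul_pos p1 p2).ne' (mul_pos p3 p4).ne', Real.log_mul p1.ne' p2.ne',
        Real.log_mul p3.ne' p4.ne'] at h6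
      linarith
  have h7 := Finset.sum_le_sum fun w (_ : w ∈ Finset.univ) => key w
  simp only [Finset.sum_sub_distrib, Finset.sum_add_distrib, ← finEntropy_eq_sum] at h7
  linarith

end Entropy

/-! ### Entropic vectors -/

theorem entropicVectors_subset_shannonCone (ι : Type*) [DecidableEq ι] :
    entropicVectors ι ⊆ shannonCone ι := by
  rintro h ⟨Ω, _, p, U, hp, hp1, hU⟩
  refine ⟨?_, fun X Y hXY => ?_, fun X Y => ?_⟩
  · rw [hU]
    exact finEntropy_eq_zero hp1 fun w w' => by
      funext i
      exact absurd i.2 (Finset.notMem_empty _)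
  · rw [hU, hU]
    refine finEntropy_mono hp fun w w' hw => ?_
    funext i
    exact congrFun hw ⟨i, hXY i.2⟩
  · simp only [hU]
    refine finEntropy_submodular hp hp1 (fun w w' hw => ?_) (fun w w' hw => ?_) fun w w' => ?_
    · funext i
      exact congrFun hw ⟨i, (Finset.mem_inter.1 i.2).1⟩
    · funext i
      exact congrFun hw ⟨i, (Finset.mem_inter.1 i.2).2⟩
    · simp only [funext_iff, Subtype.forall, Finset.mem_union, or_imp, forall_and]

/-- Tuples of natural numbers are encoded as natural numbers, so the joint variable of finitely
many variables is again a variable. -/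
theorem pullback_mem_entropicVectors {ι κ : Type*} [DecidableEq ι] (φ : κ → Finset ι)
    {h : Finset ι → ℝ} (hh : h ∈ entropicVectors ι) : pullback φ h ∈ entropicVectors κ := by
  obtain ⟨Ω, _, p, U, hp, hp1, hU⟩ := hh
  have henc : ∀ k, ∃ f : (φ k → ℕ) → ℕ, Function.Injective f := fun k =>
    Countable.exists_injective_nat _
  choose f hf using henc
  refine ⟨Ω, inferInstance, p, fun k w => f k fun i => U i w, hp, hp1, fun X => ?_⟩
  rw [pullback, hU]
  refine finEntropy_congr p fun w w' => ?_
  simp only [funext_iff, Subtype.forall, Finset.mem_biUnion, (hf _).eq_iff]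
  exact ⟨fun H k hk i hi => H i ⟨k, hk, hi⟩, fun H i ⟨k, hk, hi⟩ => H k hk i hi⟩

/-! ### Linear rank functions -/

theorem pullback_mem_vectorRanks (F : Type*) [Field F] {ι κ : Type*} [DecidableEq ι]
    (φ : κ → Finset ι) {h : Finset ι → ℝ} (hh : h ∈ vectorRanks F ι) :
    pullback φ h ∈ vectorRanks F κ := by
  obtain ⟨n, W, hW⟩ := hh
  refine ⟨n, fun k => ⨆ i ∈ φ k, W i, fun X => ?_⟩
  rw [pullback, hW, Finset.iSup_biUnion]

/-- Elements may be renamed, repeated or replaced by the zero vector; joining several elements is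
not possible with one vector per element. -/
theorem pullback_mem_scalarRanks (F : Type*) [Field F] {ι κ : Type*} [DecidableEq ι]
    (φ : κ → Option ι) {h : Finset ι → ℝ} (hh : h ∈ scalarRanks F ι) :
    pullback (fun k => (φ k).toFinset) h ∈ scalarRanks F κ := by
  obtain ⟨n, v, hv⟩ := hh
  refine ⟨n, fun k => (φ k).elim 0 v, fun X => ?_⟩
  have hspan : Submodule.span F (v '' (X.biUnion fun k => (φ k).toFinset : Finset ι)) =
      Submodule.span F ((fun k => (φ k).elim 0 v) '' (X : Set κ)) := by
    apply le_antisymm <;> rw [Submodule.span_le]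
    · rintro _ ⟨i, hi, rfl⟩
      obtain ⟨k, hk, hik⟩ := Finset.mem_biUnion.1 (Finset.mem_coe.1 hi)
      refine Submodule.subset_span ⟨k, hk, ?_⟩
      rw [Option.mem_toFinset] at hik
      simp [Option.mem_def.1 hik]
    · rintro _ ⟨k, hk, rfl⟩
      rcases hφ : φ k with _ | i
      · simp [hφ]
      · refine Submodule.subset_span ⟨i, Finset.mem_coe.2 (Finset.mem_biUnion.2 ⟨k, hk, ?_⟩), ?_⟩
        · simp [hφ]
        · simp [hφ]
  rw [pullback, hv, hspan]

theorem scalarRanks_subset_vectorRanks (F : Type*) [Field F] (ι : Type*) :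
    scalarRanks F ι ⊆ vectorRanks F ι := by
  rintro h ⟨n, v, hv⟩
  refine ⟨n, fun i => Submodule.span F {v i}, fun X => ?_⟩
  have himage : v '' (X : Set ι) = ⋃ i ∈ X, {v i} := by
    ext x
    simp [eq_comm]
  rw [hv, himage, Submodule.span_iUnion₂]

/-- A rank function of subspaces of `F ^ n`, multiplied by `log |F|`, is entropic: evaluate a
uniformly distributed linear functional on the subspaces.  The outcomes that agree on a subspace
`S` form a coset of the annihilator of `S`, which has `|F| ^ (n - dim S)` elements. -/
theorem smul_mem_entropicVectors (F : Type*) [Field F] [Finite F] {ι : Type*}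
    {h : Finset ι → ℝ} (hh : h ∈ vectorRanks F ι) :
    Real.log (Nat.card F) • h ∈ entropicVectors ι := by
  obtain ⟨n, W, hW⟩ := hh
  have hD : Finite (Module.Dual F (Fin n → F)) := Module.finite_of_finite F
  let N := Nat.card (Module.Dual F (Fin n → F))
  -- The sample space has to live in `Type`, so the dual space is replaced by `Fin N`.
  let ε : Fin N ≃ Module.Dual F (Fin n → F) := (Finite.equivFin _).symm
  have henc : ∀ i, ∃ f : (W i → F) → ℕ, Function.Injective f := fun i =>
    Countable.exists_injective_nat _
  choose f hf using henc
  have hN : (0 : ℝ) < N := Nat.cast_pos.2 Nat.card_pos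
  have hsum : ∑ _w : Fin N, (N : ℝ)⁻¹ = 1 := by
    rw [Finset.sum_const, Finset.card_univ, Fintype.card_fin, nsmul_eq_mul,
      mul_inv_cancel₀ hN.ne']
  refine ⟨Fin N, inferInstance, fun _ => (N : ℝ)⁻¹, fun i w => f i fun x => ε w x,
    fun _ => inv_nonneg.2 hN.le, hsum, fun X => ?_⟩
  set S : Submodule F (Fin n → F) := ⨆ i ∈ X, W i with hS
  set q : ℝ := (Nat.card F : ℝ) with hq
  have hq0 : 0 < q := Nat.cast_pos.2 Nat.card_pos
  have hNq : (N : ℝ) = q ^ n := by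
    have : N = Nat.card F ^ n := by
      change Nat.card (Module.Dual F (Fin n → F)) = _
      rw [Module.natCard_eq_pow_finrank (K := F), Subspace.dual_finrank_eq, Module.finrank_fin_fun]
    rw [this, Nat.cast_pow]
  have hiff : ∀ w w' : Fin N,
      ((fun i : X => f i fun x => ε w x) = fun i : X => f i fun x => ε w' x) ↔
        ε w - ε w' ∈ S.dualAnnihilator := by
    intro w w'
    rw [hS]
    simp only [funext_iff, Subtype.forall, (hf _).eq_iff, Submodule.dualAnnihilator_iSup_eq,
      Submodule.mem_iInf, Submodule.mem_dualAnnihilator, LinearMap.sub_apply, sub_eq_zero]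
  have hmass : ∀ w : Fin N, fiberMass (fun _ => (N : ℝ)⁻¹)
      (fun (w : Fin N) (i : X) => f i fun x => ε w x) w = (q ^ Module.finrank F S)⁻¹ := by
    intro w
    have hcard : (Finset.univ.filter fun w' : Fin N =>
        (fun i : X => f i fun x => ε w' x) = fun i : X => f i fun x => ε w x).card =
          Nat.card S.dualAnnihilator := by
      rw [← Fintype.card_subtype, ← Nat.card_eq_fintype_card]
      refine Nat.card_congr ((ε.trans (Equiv.subRight (ε w))).subtypeEquiv fun w' => ?_)
      exact hiff w' w
    rw [fiberMass, Finset.sum_const, hcard, Module.natCard_eq_pow_finrank (K := F), nsmul_eq_mul,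
      Nat.cast_pow, hNq, ← hq]
    have hdim := Subspace.finrank_add_finrank_dualAnnihilator_eq S
    rw [Module.finrank_fin_fun] at hdim
    have hpow : q ^ n = q ^ Module.finrank F S * q ^ Module.finrank F S.dualAnnihilator := by
      rw [← pow_add, hdim]
    rw [hpow]
    field_simp
  rw [finEntropy_eq_sum]
  simp only [hmass, Real.log_inv, neg_neg, Real.log_pow]
  rw [← Finset.sum_mul, hsum, one_mul, Pi.smul_apply, smul_eq_mul, hW, mul_comm]

theorem conicHull_vectorRanks_subset (F : Type*) [Field F] [Finite F] (ι : Type*) :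
    conicHull (vectorRanks F ι) ⊆ conicHull (entropicVectors ι) :=
  conicHull_subset_of_smul_mem (Real.log_pos (Nat.one_lt_cast.2 Finite.one_lt_card))
    fun _ => smul_mem_entropicVectors F

namespace Network

/-! ### Incidence, paths and acyclicity -/

section Incidence

variable {V E : Type*}

theorem acyclic_of_step {A B : Network V E} (hA : ∀ v, ¬ Relation.TransGen A.Step v v)
    (h : ∀ u v, B.Step u v → Relation.TransGen A.Step u v) :
    ∀ v, ¬ Relation.TransGen B.Step v v :=
  fun v hv => hA v (Relation.TransGen.lift' id h v v hv)

theorem WeakPath.symm {A : Network V E} {u v : V} (h : A.WeakPath u v) : A.WeakPath v u := by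
  have : Std.Symm fun a b => A.Step a b ∨ A.Step b a := ⟨fun _ _ h => h.symm⟩
  exact Relation.ReflTransGen.stdSymm.symm _ _ h

theorem Path.weakPath {A : Network V E} {u v : V} (h : A.Path u v) : A.WeakPath u v :=
  Relation.ReflTransGen.mono (fun _ _ h => Or.inl h) _ _ h

theorem mem_ite_empty {p : Prop} [Decidable p] {X : Finset E} {e : E} :
    (e ∈ if p then X else ∅) ↔ p ∧ e ∈ X := by
  split_ifs with h <;> simp [h]

variable [DecidableEq V]

theorem mem_inEdges (A : Network V E) {v : V} {e : E} :
    e ∈ A.inEdges v ↔ e ∈ A.edges ∧ v ∈ A.head e :=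
  Finset.mem_filter

theorem mem_outEdges (A : Network V E) {v : V} {e : E} :
    e ∈ A.outEdges v ↔ e ∈ A.edges ∧ A.tail e = v :=
  Finset.mem_filter

theorem mem_outEdgesOf (A : Network V E) {D : Finset V} {e : E} :
    e ∈ A.outEdgesOf D ↔ e ∈ A.edges ∧ A.tail e ∈ D :=
  Finset.mem_filter

theorem mem_edges_deleteSources (A : Network V E) {D : Finset V} {e : E} :
    e ∈ (A.deleteSources D).edges ↔ e ∈ A.edges ∧ A.tail e ∉ D :=
  Finset.mem_filter

/-- A part of a network in which the tails of the remaining hyperedges, the heads, and the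
demands remain, and which keeps the hyperedge of each remaining source, is a network. -/
theorem IsNetwork.of_le {A B : Network V E} (hA : A.IsNetwork)
    (hsources : B.sources ⊆ A.sources) (hnodes : B.nodes ⊆ A.nodes) (hsinks : B.sinks ⊆ A.sinks)
    (htail : B.tail = A.tail) (hedges : B.edges ⊆ A.edges)
    (hhead : ∀ e ∈ B.edges, B.head e ⊆ A.head e)
    (hhead' : ∀ e ∈ B.edges, B.head e ⊆ B.nodes ∪ B.sinks)
    (htail' : ∀ e ∈ B.edges, A.tail e ∈ B.sources ∪ B.nodes)
    (hsource : ∀ e ∈ A.edges, A.tail e ∈ B.sources → e ∈ B.edges)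
    (hdemand : ∀ t ∈ B.sinks, B.demand t ⊆ B.sources) : B.IsNetwork where
  disjoint_sources_nodes := hA.disjoint_sources_nodes.mono hsources hnodes
  disjoint_sources_sinks := hA.disjoint_sources_sinks.mono hsources hsinks
  disjoint_nodes_sinks := hA.disjoint_nodes_sinks.mono hnodes hsinks
  tail_mem := by rwa [htail]
  head_subset := hhead'
  source_edge := by
    intro s hs
    obtain ⟨e, ⟨he, rfl⟩, huniq⟩ := hA.source_edge s (hsources hs)
    refine ⟨e, ⟨hsource e he hs, by rw [htail]⟩, ?_⟩
    rintro e' ⟨he', hte'⟩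
    exact huniq e' ⟨hedges he', by rw [← hte', htail]⟩
  demand_subset := hdemand
  acyclic := acyclic_of_step hA.acyclic fun u v ⟨e, he, ht, hv⟩ =>
    Relation.TransGen.single ⟨e, hedges he, by rw [← ht, htail], hhead e he hv⟩

theorem IsNetwork.outEdges_subset_inEdges {A : Network V E} (hA : A.IsNetwork) {s v : V}
    (hs : s ∈ A.sources) (hv : v ∈ A.succs s) : A.outEdges s ⊆ A.inEdges v := by
  intro e he
  obtain ⟨e', he', hve'⟩ := Finset.mem_biUnion.1 hv
  rw [mem_outEdges] at he he'
  rw [(hA.source_edge s hs).unique he he']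
  exact A.mem_inEdges.2 ⟨he'.1, hve'⟩

theorem outEdgesOf_singleton (A : Network V E) (s : V) : A.outEdgesOf {s} = A.outEdges s := by
  ext e
  rw [mem_outEdgesOf, mem_outEdges, Finset.mem_singleton]

theorem inEdges_eq_of_head_erase (A B : Network V E) {j v : V} (hv : v ≠ j)
    (hedges : B.edges = A.edges) (hhead : ∀ e, B.head e = (A.head e).erase j) :
    B.inEdges v = A.inEdges v := by
  ext e
  rw [mem_inEdges, mem_inEdges, hedges, hhead, Finset.mem_erase, and_iff_right hv]

theorem IsNetwork.isNetwork_mergeNodes {A : Network V E} (hA : A.IsNetwork) {k j : V}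
    (hk : k ∈ A.nodes) (hj : j ∈ A.nodes) (hkj : k ≠ j) (h : A.inEdges k = A.inEdges j) :
    (A.mergeNodes k j).IsNetwork where
  disjoint_sources_nodes := hA.disjoint_sources_nodes.mono_right (Finset.erase_subset _ _)
  disjoint_sources_sinks := hA.disjoint_sources_sinks
  disjoint_nodes_sinks := hA.disjoint_nodes_sinks.mono_left (Finset.erase_subset _ _)
  tail_mem := by
    intro e he
    have h1 := hA.tail_mem e he
    simp only [mergeNodes, Finset.mem_union, Finset.mem_erase] at h1 ⊢
    split_ifs with hj'
    · exact Or.inr ⟨hkj, hk⟩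
    · exact h1.imp_right fun h2 => ⟨hj', h2⟩
  head_subset := by
    intro e he v hv
    have h1 := hA.head_subset e he (Finset.mem_of_mem_erase hv)
    have h2 := Finset.ne_of_mem_erase hv
    simp only [mergeNodes, Finset.mem_union, Finset.mem_erase] at h1 ⊢
    tauto
  source_edge := by
    intro s hs
    have hsj : j ≠ s := fun h => Finset.disjoint_left.1 hA.disjoint_sources_nodes hs (h ▸ hj)
    have hsk : k ≠ s := fun h => Finset.disjoint_left.1 hA.disjoint_sources_nodes hs (h ▸ hk)
    have hiff : ∀ e, (A.mergeNodes k j).tail e = s ↔ A.tail e = s := by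
      intro e
      simp only [mergeNodes]
      split_ifs with hj'
      · simp [hsk, hj', hsj]
      · rfl
    simp only [hiff]
    exact hA.source_edge s hs
  demand_subset := hA.demand_subset
  acyclic := by
    -- A path in the merged network lifts to one in `A` with the same end: where it leaves `k` by a
    -- former output of `j`, it can enter `j` instead, because `k` and `j` have the same inputs.
    -- Only a path that starts in `k` may have to start in `j`.
    have hstep : ∀ u v, (A.mergeNodes k j).Step u v →
        v ≠ j ∧ (A.Step u v ∨ u = k ∧ A.Step j v) := by
      rintro u v ⟨e, he, ht, hv⟩
      refine ⟨Finset.ne_of_mem_erase hv, ?_⟩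
      have hv' := Finset.mem_of_mem_erase hv
      simp only [mergeNodes] at ht
      split_ifs at ht with hj'
      · exact Or.inr ⟨ht.symm, e, he, hj', hv'⟩
      · exact Or.inl ⟨e, he, ht, hv'⟩
    have hkj' : ∀ u, A.Step u k ↔ A.Step u j := by
      intro u
      have h1 : ∀ e, (e ∈ A.edges ∧ k ∈ A.head e) ↔ (e ∈ A.edges ∧ j ∈ A.head e) := by
        intro e
        rw [← mem_inEdges, ← mem_inEdges, h]
      constructor
      · rintro ⟨e, he, ht, hv⟩
        exact ⟨e, he, ht, ((h1 e).1 ⟨he, hv⟩).2⟩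
      · rintro ⟨e, he, ht, hv⟩
        exact ⟨e, he, ht, ((h1 e).2 ⟨he, hv⟩).2⟩
    have hpath : ∀ u v, Relation.TransGen (A.mergeNodes k j).Step u v →
        Relation.TransGen A.Step u v ∨ u = k ∧ Relation.TransGen A.Step j v := by
      intro u v huv
      induction huv using Relation.TransGen.head_induction_on with
      | single h1 =>
        exact (hstep _ _ h1).2.imp Relation.TransGen.single
          (And.imp_right Relation.TransGen.single)
      | head h1 _ ih =>
        rcases ih with ih | ⟨rfl, ih⟩
        · exact (hstep _ _ h1).2.imp (fun h2 => ih.head h2)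
            (And.imp_right fun h2 => ih.head h2)
        · exact (hstep _ _ h1).2.imp (fun h2 => ih.head ((hkj' _).1 h2))
            (And.imp_right fun h2 => ih.head ((hkj' _).1 h2))
    intro v hv
    rcases hpath v v hv with h1 | ⟨rfl, h1⟩
    · exact hA.acyclic v h1
    · obtain ⟨w, h2, h3⟩ := Relation.TransGen.tail'_iff.1 h1
      exact hA.acyclic j (Relation.TransGen.tail'_iff.2 ⟨w, h2, (hkj' w).1 h3⟩)

end Incidence

/-! ### Rate regions in terms of set functions on all hyperedge labels -/

section Labels

variable {V E : Type*} [DecidableEq E]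

/-- The variables of `A` as hyperedge labels. -/
def varLabel (A : Network V E) : A.Var → Option E := fun e => some e.1

/-- The hyperedge labels as variables of `A`, where defined. -/
def labelVar (A : Network V E) : E → Option A.Var :=
  fun e => if h : e ∈ A.edges then some ⟨e, h⟩ else none

theorem pullback_labelVar (A : Network V E) (h : Finset A.Var → ℝ) :
    pullback (fun e => (A.labelVar e).toFinset) h = fun X => h (A.vars X) := by
  funext X
  rw [pullback]
  congr 1
  ext ⟨e, he⟩
  simp only [Finset.mem_biUnion, Option.mem_toFinset, labelVar, vars, Finset.mem_subtype]
  constructor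
  · rintro ⟨e', he', h'⟩
    split_ifs at h' with h1
    · obtain rfl : e' = e := by simpa using h'
      exact he'
    · simp at h'
  · exact fun h' => ⟨e, h', by simp [he]⟩

theorem pullback_varLabel_vars (A : Network V E) (H : Finset E → ℝ) {X : Finset E}
    (hX : X ⊆ A.edges) :
    pullback (fun e => (A.varLabel e).toFinset) H (A.vars X) = H X := by
  rw [pullback]
  congr 1
  ext e
  simp only [Finset.mem_biUnion, Option.mem_toFinset, varLabel, vars, Finset.mem_subtype,
    Option.mem_def, Option.some.injEq, Subtype.exists, exists_and_left, exists_prop]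
  constructor
  · rintro ⟨e', he', -, rfl⟩
    exact he'
  · exact fun h' => ⟨e, h', hX h', rfl⟩

theorem vars_union (A : Network V E) (X Y : Finset E) :
    A.vars (X ∪ Y) = A.vars X ∪ A.vars Y := by
  ext e
  simp [vars]

theorem vars_singleton (A : Network V E) {e : E} (he : e ∈ A.edges) :
    A.vars {e} = {⟨e, he⟩} := by
  ext e'
  simp [vars, Subtype.ext_iff]

/-- The set `Γ` of set functions on the variables of `A` and the set `Γ'` of set functions on all
hyperedge labels are mapped into each other by extension (labels that are not in use carry nothing)
and restriction. -/
structure Corresponds (A : Network V E) (Γ : Set (Finset A.Var → ℝ))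
    (Γ' : Set (Finset E → ℝ)) : Prop where
  extend : ∀ h ∈ Γ, pullback (fun e => (A.labelVar e).toFinset) h ∈ Γ'
  restrict : ∀ H ∈ Γ', pullback (fun e => (A.varLabel e).toFinset) H ∈ Γ

theorem corresponds_shannonCone (A : Network V E) :
    A.Corresponds (shannonCone A.Var) (shannonCone E) :=
  ⟨fun _ => pullback_mem_shannonCone _, fun _ => pullback_mem_shannonCone _⟩

theorem corresponds_entropicVectors (A : Network V E) :
    A.Corresponds (conicHull (entropicVectors A.Var)) (conicHull (entropicVectors E)) :=
  ⟨fun _ => pullback_mem_conicHull _ fun _ => pullback_mem_entropicVectors _,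
    fun _ => pullback_mem_conicHull _ fun _ => pullback_mem_entropicVectors _⟩

theorem corresponds_vectorRanks (A : Network V E) (F : Type*) [Field F] :
    A.Corresponds (conicHull (vectorRanks F A.Var)) (conicHull (vectorRanks F E)) :=
  ⟨fun _ => pullback_mem_conicHull _ fun _ => pullback_mem_vectorRanks F _,
    fun _ => pullback_mem_conicHull _ fun _ => pullback_mem_vectorRanks F _⟩

theorem corresponds_scalarRanks (A : Network V E) (F : Type*) [Field F] :
    A.Corresponds (conicHull (scalarRanks F A.Var)) (conicHull (scalarRanks F E)) :=
  ⟨fun _ => pullback_mem_conicHull _ fun _ => pullback_mem_scalarRanks F _,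
    fun _ => pullback_mem_conicHull _ fun _ => pullback_mem_scalarRanks F _⟩

end Labels

variable {V E : Type*} [DecidableEq V] [DecidableEq E]

/-- The set function `H` on the hyperedge labels satisfies all constraints of the network `A`,
with edge rates `r` and source entropies `ω`.  In contrast to `Network.region`, neither the set
function nor the rates are restricted to the labels in use, so that networks with different
hyperedges can be compared without changing types. -/
structure Realizes (A : Network V E) (H : Finset E → ℝ) (r : E → ℝ) (ω : V → ℝ) : Prop where
  indep : H (A.outEdgesOf A.sources) = ∑ s ∈ A.sources, H (A.outEdges s)
  coding : ∀ g ∈ A.nodes, Determines H (A.inEdges g) (A.outEdges g)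
  rate : ∀ e ∈ A.edges, A.tail e ∉ A.sources → H {e} ≤ r e
  decoding : ∀ t ∈ A.sinks, Determines H (A.inEdges t) (A.outEdgesOf (A.demand t))
  entropy : ∀ s ∈ A.sources, ω s = H (A.outEdges s)

/-- The set functions in `Γ` achieve the edge rates `r` and the source entropies `ω`. -/
def Achieves (A : Network V E) (Γ : Set (Finset E → ℝ)) (r : E → ℝ) (ω : V → ℝ) : Prop :=
  ∃ H ∈ Γ, A.Realizes H r ω

theorem Achieves.mono {A : Network V E} {Γ₁ Γ₂ : Set (Finset E → ℝ)} (h : Γ₁ ⊆ Γ₂)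
    {r : E → ℝ} {ω : V → ℝ} (hA : A.Achieves Γ₁ r ω) : A.Achieves Γ₂ r ω := by
  obtain ⟨H, hH, hR⟩ := hA
  exact ⟨H, h hH, hR⟩

theorem mem_region_iff (A : Network V E) {Γ : Set (Finset A.Var → ℝ)}
    {Γ' : Set (Finset E → ℝ)} (hΓ : A.Corresponds Γ Γ') (r : E → ℝ) (ω : V → ℝ) :
    ((fun e => r e.1, fun s => ω s.1) : (A.CodedEdge → ℝ) × (A.Source → ℝ)) ∈ A.region Γ ↔
      A.Achieves Γ' r ω := by
  -- All sets of hyperedges in the constraints consist of labels in use.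
  have key : ∀ (h : Finset A.Var → ℝ) (H : Finset E → ℝ),
      (∀ X ⊆ A.edges, h (A.vars X) = H X) →
      ((A.SourceIndependence h ∧ A.NodeCoding h ∧
        A.RateConstraint h (fun e => r e.1) ∧ A.SinkDecoding h ∧
        ∀ s : A.Source, ω s.1 = h (A.vars (A.outEdges s.1))) ↔ A.Realizes H r ω) := by
    intro h H hH
    have hin : ∀ v, A.inEdges v ⊆ A.edges := fun v => Finset.filter_subset _ _
    have hout : ∀ v, A.outEdges v ⊆ A.edges := fun v => Finset.filter_subset _ _
    have houtOf : ∀ D, A.outEdgesOf D ⊆ A.edges := fun v => Finset.filter_subset _ _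
    have h1 : A.SourceIndependence h ↔
        H (A.outEdgesOf A.sources) = ∑ s ∈ A.sources, H (A.outEdges s) := by
      rw [SourceIndependence, hH _ (houtOf _),
        Finset.sum_congr rfl fun s _ => hH _ (hout s)]
    have h2 : A.NodeCoding h ↔ ∀ g ∈ A.nodes, Determines H (A.inEdges g) (A.outEdges g) := by
      refine forall₂_congr fun g _ => ?_
      rw [← vars_union, hH _ (Finset.union_subset (hout _) (hin _)), hH _ (hin _), Determines]
    have h3 : A.RateConstraint h (fun e => r e.1) ↔
        ∀ e ∈ A.edges, A.tail e ∉ A.sources → H {e} ≤ r e := by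
      rw [RateConstraint, Subtype.forall]
      constructor
      · intro h' e he hs
        have := h' e ⟨he, hs⟩
        rwa [← vars_singleton A he, hH _ (Finset.singleton_subset_iff.2 he)] at this
      · rintro h' e ⟨he, hs⟩
        rw [← vars_singleton A he, hH _ (Finset.singleton_subset_iff.2 he)]
        exact h' e he hs
    have h4 : A.SinkDecoding h ↔
        ∀ t ∈ A.sinks, Determines H (A.inEdges t) (A.outEdgesOf (A.demand t)) := by
      refine forall₂_congr fun t _ => ?_
      rw [← vars_union, hH _ (Finset.union_subset (houtOf _) (hin _)), hH _ (hin _), Determines]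
    have h5 : (∀ s : A.Source, ω s.1 = h (A.vars (A.outEdges s.1))) ↔
        ∀ s ∈ A.sources, ω s = H (A.outEdges s) := by
      rw [Subtype.forall]
      refine forall₂_congr fun s _ => ?_
      rw [hH _ (hout _)]
    rw [h1, h2, h3, h4, h5]
    exact ⟨fun ⟨a, b, c, d, e⟩ => ⟨a, b, c, d, e⟩, fun ⟨a, b, c, d, e⟩ => ⟨a, b, c, d, e⟩⟩
  constructor
  · rintro ⟨h, hh, hc⟩
    refine ⟨_, hΓ.extend h hh, (key h _ fun X _ => ?_).1 hc⟩
    rw [pullback_labelVar]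
  · rintro ⟨H, hH, hc⟩
    exact ⟨_, hΓ.restrict H hH, (key _ H fun X hX => A.pullback_varLabel_vars H hX).2 hc⟩

theorem region_eq_iff (A : Network V E) {Γ₁ Γ₂ : Set (Finset A.Var → ℝ)}
    {Γ₁' Γ₂' : Set (Finset E → ℝ)} (h₁ : A.Corresponds Γ₁ Γ₁') (h₂ : A.Corresponds Γ₂ Γ₂') :
    A.region Γ₁ = A.region Γ₂ ↔ ∀ r ω, A.Achieves Γ₁' r ω ↔ A.Achieves Γ₂' r ω := by
  constructor
  · intro h r ω
    rw [← A.mem_region_iff h₁, ← A.mem_region_iff h₂, h]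
  · intro h
    ext ⟨r, ω⟩
    -- Rates and entropies extend by zero to the labels that are not in use.
    let r' : E → ℝ := fun e => if he : e ∈ A.edges ∧ A.tail e ∉ A.sources then r ⟨e, he⟩ else 0
    let ω' : V → ℝ := fun s => if hs : s ∈ A.sources then ω ⟨s, hs⟩ else 0
    have hx : ((fun e => r' e.1, fun s => ω' s.1) : (A.CodedEdge → ℝ) × (A.Source → ℝ)) =
        (r, ω) := by
      refine Prod.ext (funext fun e => dif_pos e.2) (funext fun s => dif_pos s.2)
    rw [← hx, A.mem_region_iff h₁, A.mem_region_iff h₂, h]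

/-! ### Simulation of networks -/

/-- The network `A` simulates `B`: each realization `(H, r, ω)` of `B` yields one of `A`, in which
each hyperedge of `A` carries the joint variable of a set of hyperedges of `B`, and whose rates and
source entropies `(r', ω')` are so restrictive that every polymatroid that realizes them in `A`
also realizes `(r, ω)` in `B`. -/
def Simulates (A B : Network V E) : Prop :=
  ∀ H ∈ shannonCone E, ∀ r ω, B.Realizes H r ω →
    ∃ (φ : E → Finset E) (r' : E → ℝ) (ω' : V → ℝ), A.Realizes (pullback φ H) r' ω' ∧
      ∀ H' ∈ shannonCone E, A.Realizes H' r' ω' → B.Realizes H' r ω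

theorem Simulates.refl (A : Network V E) : A.Simulates A := fun H _ r ω h =>
  ⟨fun e => {e}, r, ω, by rwa [pullback_id], fun _ _ h' => h'⟩

theorem Simulates.trans {A B C : Network V E} (hAB : A.Simulates B) (hBC : B.Simulates C) :
    A.Simulates C := by
  intro H hH r ω h
  obtain ⟨φ, r₁, ω₁, h₁, h₁'⟩ := hBC H hH r ω h
  obtain ⟨ψ, r₂, ω₂, h₂, h₂'⟩ := hAB _ (pullback_mem_shannonCone φ hH) r₁ ω₁ h₁
  rw [pullback_pullback] at h₂
  exact ⟨_, r₂, ω₂, h₂, fun H' hH' h' => h₁' H' hH' (h₂' H' hH' h')⟩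

/-- The larger class `Γ₂` brings a realization of `B` to `A`; there it may be replaced by one from
`Γ₁`, which realizes `B` as well.  So only `Γ₂` has to be closed under joint variables. -/
theorem Simulates.achieves_iff {A B : Network V E} (hAB : A.Simulates B)
    {Γ₁ Γ₂ : Set (Finset E → ℝ)} (h₁₂ : Γ₁ ⊆ Γ₂) (h₂ : Γ₂ ⊆ shannonCone E)
    (hpull : ∀ (φ : E → Finset E), ∀ H ∈ Γ₂, pullback φ H ∈ Γ₂)
    (hA : ∀ r ω, A.Achieves Γ₁ r ω ↔ A.Achieves Γ₂ r ω) (r : E → ℝ) (ω : V → ℝ) :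
    B.Achieves Γ₁ r ω ↔ B.Achieves Γ₂ r ω := by
  refine ⟨Achieves.mono h₁₂, ?_⟩
  rintro ⟨H, hH, hR⟩
  obtain ⟨φ, r', ω', hA', hB'⟩ := hAB H (h₂ hH) r ω hR
  obtain ⟨H', hH', hR'⟩ := (hA r' ω').2 ⟨_, hpull φ H hH, hA'⟩
  exact ⟨H', hH', hB' H' (h₂ (h₁₂ hH')) hR'⟩

/-- If `A` simulates `B`, then `B` inherits from `A` the sufficiency of linear codes and the
tightness of the Shannon outer bound. -/
theorem Simulates.inherit {A B : Network V E} (h : A.Simulates B) (F : Type*) [Field F]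
    [Finite F] :
    (A.VectorCodesSuffice F → B.VectorCodesSuffice F) ∧
      (A.ScalarCodesSuffice F → B.ScalarCodesSuffice F) ∧
      (A.ShannonTight → B.ShannonTight) := by
  have hES : conicHull (entropicVectors E) ⊆ shannonCone E :=
    conicHull_subset_shannonCone (entropicVectors_subset_shannonCone E)
  have hVE := conicHull_vectorRanks_subset F E
  have hSV : conicHull (scalarRanks F E) ⊆ conicHull (vectorRanks F E) :=
    Submodule.span_mono (scalarRanks_subset_vectorRanks F E)
  have hpull : ∀ (φ : E → Finset E), ∀ H ∈ conicHull (entropicVectors E),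
      pullback φ H ∈ conicHull (entropicVectors E) := fun φ _ =>
    pullback_mem_conicHull φ fun _ => pullback_mem_entropicVectors φ
  refine ⟨fun hA => ?_, fun hA => ?_, fun hA => ?_⟩
  · exact (B.region_eq_iff (B.corresponds_vectorRanks F) B.corresponds_entropicVectors).2
      (h.achieves_iff hVE hES hpull
        ((A.region_eq_iff (A.corresponds_vectorRanks F) A.corresponds_entropicVectors).1 hA))
  · exact (B.region_eq_iff (B.corresponds_scalarRanks F) B.corresponds_entropicVectors).2
      (h.achieves_iff (hSV.trans hVE) hES hpull
        ((A.region_eq_iff (A.corresponds_scalarRanks F) A.corresponds_entropicVectors).1 hA))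
  · exact (B.region_eq_iff B.corresponds_shannonCone B.corresponds_entropicVectors).2
      fun r ω => (h.achieves_iff hES subset_rfl (fun φ _ => pullback_mem_shannonCone φ)
        (fun r ω => ((A.region_eq_iff A.corresponds_shannonCone
          A.corresponds_entropicVectors).1 hA r ω).symm) r ω).symm

/-! ### Deletions -/

/-- Removing a set `N` of hyperedges, together with nodes that are cut off by this, amounts to
setting the rates and source entropies of the hyperedges in `N` to zero.  The nodes and sinks
that remain lose only inputs in `N`, and the hypotheses on the nodes that disappear say that their
constraints become trivial. -/
theorem simulates_of_null {A B : Network V E} (N : Finset E)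
    (htail : B.tail = A.tail) (hedges : B.edges = A.edges \ N)
    (hsources : B.sources ⊆ A.sources) (hnodes : B.nodes ⊆ A.nodes) (hsinks : B.sinks ⊆ A.sinks)
    (hin : ∀ v ∈ B.nodes ∪ B.sinks, B.inEdges v = A.inEdges v \ N)
    (hsource : ∀ e ∈ A.edges, A.tail e ∈ A.sources → (e ∈ N ↔ A.tail e ∉ B.sources))
    (hnode : ∀ g ∈ A.nodes, g ∉ B.nodes → A.outEdges g ⊆ N)
    (hdemand : ∀ t ∈ B.sinks, B.outEdgesOf (B.demand t) = A.outEdgesOf (A.demand t) \ N)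
    (hdemand' : ∀ t ∈ A.sinks, t ∉ B.sinks → A.outEdgesOf (A.demand t) ⊆ N) :
    A.Simulates B := by
  have hout : ∀ v, B.outEdges v = A.outEdges v \ N := by
    intro v
    ext e
    simp only [mem_outEdges, Finset.mem_sdiff, htail, hedges]
    tauto
  have hall : B.outEdgesOf B.sources = A.outEdgesOf A.sources \ N := by
    ext e
    simp only [mem_outEdgesOf, Finset.mem_sdiff, htail, hedges]
    constructor
    · rintro ⟨⟨he, heN⟩, hs⟩
      exact ⟨⟨he, hsources hs⟩, heN⟩
    · rintro ⟨⟨he, hs⟩, heN⟩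
      refine ⟨⟨he, heN⟩, ?_⟩
      by_contra h
      exact heN ((hsource e he hs).2 h)
  have hgone : ∀ s ∈ A.sources, s ∉ B.sources → A.outEdges s \ N = ∅ := by
    intro s hs hsB
    rw [Finset.sdiff_eq_empty_iff_subset]
    intro e he
    obtain ⟨he', rfl⟩ := A.mem_outEdges.1 he
    exact (hsource e he' hs).2 hsB
  intro H hH r ω h
  have hpull : ∀ X, pullback (fun e => if e ∈ N then ∅ else {e}) H X = H (X \ N) := by
    intro X
    rw [pullback]
    congr 1
    ext e
    simp only [Finset.mem_biUnion, Finset.mem_sdiff]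
    constructor
    · rintro ⟨e', he', h'⟩
      split_ifs at h' with hN
      · simp at h'
      · obtain rfl := Finset.mem_singleton.1 h'
        exact ⟨he', hN⟩
    · rintro ⟨he, hN⟩
      exact ⟨e, he, by simp [hN]⟩
  refine ⟨fun e => if e ∈ N then ∅ else {e}, fun e => if e ∈ N then 0 else r e,
    fun s => if s ∈ B.sources then ω s else 0, ?_, fun H' hH' h' => ?_⟩
  · constructor
    · rw [hpull, ← hall, h.indep, ← Finset.sum_subset hsources]
      · refine Finset.sum_congr rfl fun s _ => ?_
        rw [hpull, hout]
      · intro s hs hsB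
        rw [hpull, hgone s hs hsB, hH.1]
    · intro g hg
      rw [Determines, hpull, hpull, Finset.union_sdiff_distrib]
      by_cases hgB : g ∈ B.nodes
      · rw [← hout, ← hin g (Finset.mem_union_left _ hgB)]
        exact h.coding g hgB
      · rw [Finset.sdiff_eq_empty_iff_subset.2 (hnode g hg hgB), Finset.empty_union]
    · intro e he hs
      rw [hpull]
      split_ifs with hN
      · rw [Finset.sdiff_eq_empty_iff_subset.2 (Finset.singleton_subset_iff.2 hN), hH.1]
      · rw [Finset.sdiff_eq_self_of_disjoint (Finset.disjoint_singleton_left.2 hN)]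
        refine h.rate e (by simp [hedges, he, hN]) ?_
        rw [htail]
        exact fun hs' => hs (hsources hs')
    · intro t ht
      rw [Determines, hpull, hpull, Finset.union_sdiff_distrib]
      by_cases htB : t ∈ B.sinks
      · rw [← hdemand t htB, ← hin t (Finset.mem_union_right _ htB)]
        exact h.decoding t htB
      · rw [Finset.sdiff_eq_empty_iff_subset.2 (hdemand' t ht htB), Finset.empty_union]
    · intro s hs
      rw [hpull]
      split_ifs with hsB
      · rw [← hout, h.entropy s hsB]
      · rw [hgone s hs hsB, hH.1]
  · have hnull : ∀ e ∈ A.edges, e ∈ N → H' {e} ≤ 0 := by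
      intro e he hN
      by_cases hs : A.tail e ∈ A.sources
      · have h1 := h'.entropy _ hs
        rw [if_neg ((hsource e he hs).1 hN)] at h1
        rw [h1]
        exact hH'.2.1 _ _ (Finset.singleton_subset_iff.2 (by simp [outEdges, he]))
      · have h1 := h'.rate e he hs
        rwa [if_pos hN] at h1
    have hdet : ∀ X ⊆ A.edges, Determines H' (X \ N) X := by
      intro X hX
      refine Determines.of_forall hH' fun e he => ?_
      by_cases hN : e ∈ N
      · exact Determines.of_nonpos hH' (hnull e (hX he) hN)
      · exact Determines.of_subset
          (Finset.singleton_subset_iff.2 (Finset.mem_sdiff.2 ⟨he, hN⟩))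
    have heq : ∀ X ⊆ A.edges, H' (X \ N) = H' X := fun X hX =>
      Determines.eq (Determines.of_subset Finset.sdiff_subset) (hdet X hX)
    constructor
    · rw [hall, heq (A.outEdgesOf _) (Finset.filter_subset _ _), h'.indep, ← Finset.sum_subset hsources]
      · refine Finset.sum_congr rfl fun s _ => ?_
        rw [hout, heq (A.outEdges s) (Finset.filter_subset _ _)]
      · intro s hs hsB
        rw [← heq (A.outEdges s) (Finset.filter_subset _ _), hgone s hs hsB, hH'.1]
    · intro g hg
      rw [hout, hin g (Finset.mem_union_left _ hg)]
      exact ((hdet _ (Finset.filter_subset _ _)).trans hH' (h'.coding g (hnodes hg))).anti_right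
        hH' Finset.sdiff_subset
    · intro e he hs
      rw [hedges, Finset.mem_sdiff] at he
      rw [htail] at hs
      have h1 := h'.rate e he.1 fun hsA => he.2 ((hsource e he.1 hsA).2 hs)
      rwa [if_neg he.2] at h1
    · intro t ht
      rw [hdemand t ht, hin t (Finset.mem_union_right _ ht)]
      exact ((hdet _ (Finset.filter_subset _ _)).trans hH' (h'.decoding t (hsinks ht))).anti_right
        hH' Finset.sdiff_subset
    · intro s hs
      rw [hout, heq (A.outEdges s) (Finset.filter_subset _ _), ← h'.entropy s (hsources hs),
        if_pos hs]

/-- `B` is a network that is simulated by `A`.  Every step of the passage to a minor is of this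
kind, and the first part is what allows the steps to be iterated. -/
structure Refines (A B : Network V E) : Prop where
  isNetwork : B.IsNetwork
  simulates : A.Simulates B

theorem Refines.trans {A B C : Network V E} (h : A.Refines B) (h' : B.Refines C) :
    A.Refines C :=
  ⟨h'.isNetwork, h.simulates.trans h'.simulates⟩

theorem IsNetwork.refines_deleteSources {A : Network V E} (hA : A.IsNetwork) (D : Finset V) :
    A.Refines (A.deleteSources D) where
  isNetwork := by
    refine hA.of_le Finset.sdiff_subset subset_rfl subset_rfl rfl (Finset.filter_subset _ _)
      (fun _ _ => subset_rfl) (fun e he => hA.head_subset e (Finset.mem_filter.1 he).1) ?_ ?_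
      fun t ht => Finset.sdiff_subset_sdiff (hA.demand_subset t ht) subset_rfl
    · intro e he
      obtain ⟨he, hD⟩ := Finset.mem_filter.1 he
      have := hA.tail_mem e he
      simp only [deleteSources, Finset.mem_union, Finset.mem_sdiff] at this ⊢
      tauto
    · intro e he hs
      exact Finset.mem_filter.2 ⟨he, (Finset.mem_sdiff.1 hs).2⟩
  simulates := by
    refine simulates_of_null (A.outEdgesOf D) rfl ?_ Finset.sdiff_subset subset_rfl subset_rfl
      ?_ ?_ (fun _ h h' => absurd h h') ?_ fun _ h h' => absurd h h'
    · ext e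
      simp only [deleteSources, mem_outEdgesOf, Finset.mem_filter, Finset.mem_sdiff]
      tauto
    · intro v _
      ext e
      simp only [deleteSources, mem_inEdges, mem_outEdgesOf, Finset.mem_filter, Finset.mem_sdiff]
      tauto
    · intro e he hs
      simp only [deleteSources, mem_outEdgesOf, Finset.mem_sdiff]
      tauto
    · intro t _
      ext e
      simp only [deleteSources, mem_outEdgesOf, Finset.mem_filter, Finset.mem_sdiff]
      tauto

theorem IsNetwork.refines_deleteEdge {A : Network V E} (hA : A.IsNetwork) {e : E}
    (hs : A.tail e ∉ A.sources) : A.Refines (A.deleteEdge e) where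
  isNetwork := by
    refine hA.of_le subset_rfl subset_rfl subset_rfl rfl (Finset.erase_subset _ _)
      (fun _ _ => subset_rfl) (fun e' he => hA.head_subset e' (Finset.mem_of_mem_erase he))
      (fun e' he => hA.tail_mem e' (Finset.mem_of_mem_erase he)) ?_ hA.demand_subset
    intro e' he' hs'
    refine Finset.mem_erase.2 ⟨?_, he'⟩
    rintro rfl
    exact hs hs'
  simulates := by
    refine simulates_of_null {e} rfl (Finset.erase_eq _ _) subset_rfl subset_rfl subset_rfl
      ?_ ?_ (fun _ h h' => absurd h h') ?_ fun _ h h' => absurd h h'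
    · intro v _
      ext e'
      simp only [deleteEdge, mem_inEdges, Finset.mem_sdiff, Finset.mem_erase,
        Finset.mem_singleton]
      tauto
    · intro e' _ hs'
      rw [Finset.mem_singleton]
      refine ⟨?_, fun h => absurd hs' h⟩
      rintro rfl
      exact absurd hs' hs
    · intro t _
      ext e'
      simp only [deleteEdge, mem_outEdgesOf, Finset.mem_sdiff, Finset.mem_erase,
        Finset.mem_singleton]
      tauto

theorem IsNetwork.refines_deleteNode {A : Network V E} (hA : A.IsNetwork) {g : V}
    (hg : g ∈ A.nodes) : A.Refines (A.deleteNode g) := by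
  have hgs : g ∉ A.sources := Finset.disjoint_right.1 hA.disjoint_sources_nodes hg
  have hgt : g ∉ A.sinks := Finset.disjoint_left.1 hA.disjoint_nodes_sinks hg
  constructor
  · refine hA.of_le subset_rfl (Finset.erase_subset _ _) subset_rfl rfl (Finset.filter_subset _ _)
      (fun _ _ => Finset.erase_subset _ _) ?_ ?_ ?_ hA.demand_subset
    · intro e he v hv
      have h1 := hA.head_subset e (Finset.mem_filter.1 he).1 (Finset.mem_of_mem_erase hv)
      have h2 := Finset.ne_of_mem_erase hv
      simp only [deleteNode, Finset.mem_union, Finset.mem_erase] at h1 ⊢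
      tauto
    · intro e he
      obtain ⟨he, hne⟩ := Finset.mem_filter.1 he
      have := hA.tail_mem e he
      simp only [deleteNode, Finset.mem_union, Finset.mem_erase] at this ⊢
      tauto
    · intro e he hs
      refine Finset.mem_filter.2 ⟨he, ?_⟩
      rintro rfl
      exact hgs hs
  · refine simulates_of_null (A.outEdges g) rfl ?_ subset_rfl (Finset.erase_subset _ _) subset_rfl
      ?_ ?_ ?_ ?_ fun _ h h' => absurd h h'
    · ext e
      simp only [deleteNode, mem_outEdges, Finset.mem_filter, Finset.mem_sdiff]
      tauto
    · intro v hv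
      have hvg : v ≠ g := by
        rintro rfl
        simp [deleteNode, hgt] at hv
      ext e
      simp only [deleteNode, mem_inEdges, mem_outEdges, Finset.mem_filter, Finset.mem_sdiff,
        Finset.mem_erase]
      tauto
    · intro e he hs
      refine ⟨fun h => ?_, fun h => absurd hs h⟩
      rw [(Finset.mem_filter.1 h).2] at hs
      exact absurd hs hgs
    · intro g' hg' hg''
      have : g' = g := by
        by_contra h
        exact hg'' (Finset.mem_erase.2 ⟨h, hg'⟩)
      rw [this]
    · intro t ht
      have hsub := hA.demand_subset t ht
      ext e
      have : A.tail e ∈ A.demand t → A.tail e ≠ g := by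
        rintro h1 rfl
        exact hgs (hsub h1)
      simp only [deleteNode, mem_outEdges, mem_outEdgesOf, Finset.mem_filter, Finset.mem_sdiff]
      tauto

/-- A sink can be deleted together with all sources that it demands. -/
theorem IsNetwork.refines_deleteSink {A : Network V E} (hA : A.IsNetwork) {t : V}
    (ht : t ∈ A.sinks) : A.Refines ((A.deleteSink t).deleteSources (A.demand t)) := by
  have htg : t ∉ A.nodes := Finset.disjoint_right.1 hA.disjoint_nodes_sinks ht
  constructor
  · refine hA.of_le Finset.sdiff_subset subset_rfl (Finset.erase_subset _ _) rfl
      (Finset.filter_subset _ _) (fun _ _ => Finset.erase_subset _ _) ?_ ?_ ?_ ?_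
    · intro e he v hv
      have h1 := hA.head_subset e (Finset.mem_filter.1 he).1 (Finset.mem_of_mem_erase hv)
      have h2 := Finset.ne_of_mem_erase hv
      simp only [deleteSink, deleteSources, Finset.mem_union, Finset.mem_erase] at h1 ⊢
      tauto
    · intro e he
      obtain ⟨he, hne⟩ := Finset.mem_filter.1 he
      have h1 := hA.tail_mem e he
      simp only [deleteSink, deleteSources, Finset.mem_union, Finset.mem_sdiff] at h1 hne ⊢
      tauto
    · intro e he hs
      exact Finset.mem_filter.2 ⟨he, (Finset.mem_sdiff.1 hs).2⟩
    · intro t' ht'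
      exact Finset.sdiff_subset_sdiff
        (hA.demand_subset t' (Finset.mem_of_mem_erase ht')) subset_rfl
  · refine simulates_of_null (A.outEdgesOf (A.demand t)) rfl ?_ Finset.sdiff_subset subset_rfl
      (Finset.erase_subset _ _) ?_ ?_ (fun _ h h' => absurd h h') ?_ ?_
    · ext e
      simp only [mem_outEdgesOf, mem_edges_deleteSources, Finset.mem_sdiff]
      simp only [deleteSink]
      tauto
    · intro v hv
      have hvt : v ≠ t := by
        rintro rfl
        simp [deleteSink, deleteSources, htg] at hv
      ext e
      simp only [mem_inEdges, mem_outEdgesOf, mem_edges_deleteSources, Finset.mem_sdiff]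
      simp only [deleteSink, deleteSources, Finset.mem_erase]
      tauto
    · intro e he hs
      simp only [mem_outEdgesOf]
      simp only [deleteSink, deleteSources, Finset.mem_sdiff]
      tauto
    · intro t' _
      ext e
      simp only [mem_outEdgesOf, mem_edges_deleteSources, Finset.mem_sdiff]
      simp only [deleteSink, deleteSources, Finset.mem_sdiff]
      tauto
    · intro t' ht' ht''
      have : t' = t := by
        by_contra h
        exact ht'' (Finset.mem_erase.2 ⟨h, ht'⟩)
      rw [this]

theorem IsNetwork.refines_deleteSink_of_demand_eq_empty {A : Network V E} (hA : A.IsNetwork)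
    {t : V} (ht : t ∈ A.sinks) (h : A.demand t = ∅) : A.Refines (A.deleteSink t) := by
  have h1 := hA.refines_deleteSink ht
  have h2 : (A.deleteSink t).deleteSources (A.demand t) = A.deleteSink t := by
    simp [deleteSources, deleteSink, h]
  rwa [h2] at h1

/-- A weakly connected component arises by removing the hyperedges outside.  Each sink has paths
from the sources that it demands, so these lie in the same component. -/
theorem IsNetwork.refines_component {A : Network V E} (hA : A.IsNetwork) (v : V)
    (hpath : A.MinCond 10) : A.Refines (A.component v) := by
  classical
  have hstep : ∀ e ∈ A.edges, ∀ u ∈ A.head e, A.WeakPath v u ↔ A.WeakPath v (A.tail e) := by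
    intro e he u hu
    have h : A.WeakPath (A.tail e) u := Relation.ReflTransGen.single (Or.inl ⟨e, he, rfl, hu⟩)
    exact ⟨fun h' => h'.trans h.symm, fun h' => h'.trans h⟩
  have hdem : ∀ t ∈ A.sinks, ∀ s ∈ A.demand t, A.WeakPath v s ↔ A.WeakPath v t := by
    intro t ht s hs
    have h : A.WeakPath s t := Path.weakPath (hpath t ht s hs)
    exact ⟨fun h' => h'.trans h, fun h' => h'.trans h.symm⟩
  constructor
  · refine hA.of_le (Finset.filter_subset _ _) (Finset.filter_subset _ _)
      (Finset.filter_subset _ _) rfl (Finset.filter_subset _ _) (fun _ _ => subset_rfl) ?_ ?_ ?_ ?_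
    · intro e he u hu
      obtain ⟨he, hv⟩ := Finset.mem_filter.1 he
      have h1 := hA.head_subset e he hu
      have h2 := (hstep e he u hu).2 hv
      simp only [component, Finset.mem_union, Finset.mem_filter] at h1 ⊢
      tauto
    · intro e he
      obtain ⟨he, hv⟩ := Finset.mem_filter.1 he
      have h1 := hA.tail_mem e he
      simp only [component, Finset.mem_union, Finset.mem_filter] at h1 ⊢
      tauto
    · intro e he hs
      exact Finset.mem_filter.2 ⟨he, (Finset.mem_filter.1 hs).2⟩
    · intro t ht s hs
      obtain ⟨hs, hvs⟩ := Finset.mem_filter.1 hs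
      exact Finset.mem_filter.2 ⟨hA.demand_subset t (Finset.mem_filter.1 ht).1 hs, hvs⟩
  · refine simulates_of_null (A.edges \ (A.component v).edges) rfl ?_ (Finset.filter_subset _ _)
      (Finset.filter_subset _ _) (Finset.filter_subset _ _) ?_ ?_ ?_ ?_ ?_
    · rw [Finset.sdiff_sdiff_eq_self]
      exact Finset.filter_subset _ _
    · intro u _
      ext e
      simp only [component, mem_inEdges, Finset.mem_filter, Finset.mem_sdiff]
      tauto
    · intro e he hs
      simp only [component, Finset.mem_filter, Finset.mem_sdiff]
      tauto
    · intro g hg hg' e he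
      obtain ⟨he, rfl⟩ := Finset.mem_filter.1 he
      simp only [component, Finset.mem_filter, Finset.mem_sdiff] at hg' ⊢
      tauto
    · intro t _
      ext e
      simp only [component, mem_outEdgesOf, Finset.mem_filter, Finset.mem_sdiff]
      tauto
    · intro t ht ht' e he
      obtain ⟨he, hte⟩ := Finset.mem_filter.1 he
      have h1 := hdem t ht _ hte
      simp only [component, Finset.mem_filter, Finset.mem_sdiff] at ht' ⊢
      tauto

/-! ### Modifications that do not change the constraints -/

theorem simulates_of_realizes_iff {A B : Network V E}
    (h : ∀ H ∈ shannonCone E, ∀ r ω, A.Realizes H r ω ↔ B.Realizes H r ω) : A.Simulates B :=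
  fun H hH r ω hR => ⟨fun e => {e}, r, ω, by rwa [pullback_id, h H hH],
    fun H' hH' => (h H' hH' r ω).1⟩

theorem IsNetwork.refines_dropDemand {A : Network V E} (hA : A.IsNetwork) {t : V} (ht : t ∈ A.sinks)
    {D : Finset V} (h : ∀ H ∈ shannonCone E, ∀ r ω, (A.dropDemand t D).Realizes H r ω →
      Determines H (A.inEdges t) (A.outEdgesOf D)) : A.Refines (A.dropDemand t D) := by
  have hne : ∀ t', t' ≠ t → (A.dropDemand t D).demand t' = A.demand t' := fun t' h' =>
    Function.update_of_ne h' _ _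
  have heq : (A.dropDemand t D).demand t = A.demand t \ D := Function.update_self _ _ _
  constructor
  · refine hA.of_le subset_rfl subset_rfl subset_rfl rfl subset_rfl (fun _ _ => subset_rfl)
      hA.head_subset hA.tail_mem (fun _ h _ => h) fun t' ht' => ?_
    by_cases htt : t' = t
    · rw [htt, heq]
      exact Finset.sdiff_subset.trans (hA.demand_subset t ht)
    · rw [hne t' htt]
      exact hA.demand_subset t' ht'
  · refine simulates_of_realizes_iff fun H hH r ω => ⟨fun hR => ?_, fun hR => ?_⟩
    · refine ⟨hR.indep, hR.coding, hR.rate, fun t' ht' => ?_, hR.entropy⟩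
      by_cases htt : t' = t
      · rw [htt, heq]
        refine (hR.decoding t ht).anti_right hH fun e he => ?_
        change e ∈ A.outEdgesOf _ at he
        rw [mem_outEdgesOf, Finset.mem_sdiff] at he
        exact A.mem_outEdgesOf.2 ⟨he.1, he.2.1⟩
      · rw [hne t' htt]
        exact hR.decoding t' ht'
    · refine ⟨hR.indep, hR.coding, hR.rate, fun t' ht' => ?_, hR.entropy⟩
      have h1 := hR.decoding t' ht'
      by_cases htt : t' = t
      · rw [htt, heq] at h1
        rw [htt]
        refine (h1.union hH (h H hH r ω hR)).anti_right hH fun e he => ?_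
        rw [mem_outEdgesOf] at he
        rw [Finset.mem_union, mem_outEdgesOf, mem_outEdgesOf, Finset.mem_sdiff]
        by_cases hD : A.tail e ∈ D
        · exact Or.inr ⟨he.1, hD⟩
        · exact Or.inl ⟨he.1, he.2, hD⟩
      · rwa [hne t' htt] at h1

theorem IsNetwork.refines_mergeSinks {A : Network V E} (hA : A.IsNetwork) {t t' : V}
    (ht : t ∈ A.sinks) (ht' : t' ∈ A.sinks) (hne : t ≠ t') (h : A.inEdges t = A.inEdges t') :
    A.Refines (A.mergeSinks t t') := by
  have hdem : ∀ u, u ≠ t → (A.mergeSinks t t').demand u = A.demand u := fun u h' =>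
    Function.update_of_ne h' _ _
  have hdemt : (A.mergeSinks t t').demand t = A.demand t ∪ A.demand t' :=
    Function.update_self _ _ _
  have hin : ∀ v, v ≠ t' → (A.mergeSinks t t').inEdges v = A.inEdges v := fun v hv =>
    inEdges_eq_of_head_erase A _ hv rfl fun _ => rfl
  have hnode : ∀ g ∈ A.nodes, g ≠ t' := by
    rintro g hg rfl
    exact Finset.disjoint_left.1 hA.disjoint_nodes_sinks hg ht'
  have hout : ∀ D, (A.mergeSinks t t').outEdgesOf D = A.outEdgesOf D := fun _ => rfl
  have hunion : ∀ D D', A.outEdgesOf (D ∪ D') = A.outEdgesOf D ∪ A.outEdgesOf D' := by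
    intro D D'
    ext e
    simp only [mem_outEdgesOf, Finset.mem_union]
    tauto
  constructor
  · refine hA.of_le subset_rfl subset_rfl (Finset.erase_subset _ _) rfl subset_rfl
      (fun _ _ => Finset.erase_subset _ _) (fun e he v hv => ?_) hA.tail_mem (fun _ h _ => h)
      fun u hu => ?_
    · have h1 := hA.head_subset e he (Finset.mem_of_mem_erase hv)
      have h2 := Finset.ne_of_mem_erase hv
      simp only [mergeSinks, Finset.mem_union, Finset.mem_erase] at h1 ⊢
      tauto
    · by_cases hut : u = t
      · rw [hut, hdemt]
        exact Finset.union_subset (hA.demand_subset t ht) (hA.demand_subset t' ht')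
      · rw [hdem u hut]
        exact hA.demand_subset u (Finset.mem_of_mem_erase hu)
  · refine simulates_of_realizes_iff fun H hH r ω => ⟨fun hR => ?_, fun hR => ?_⟩
    · refine ⟨hR.indep, fun g hg => ?_, hR.rate, fun u hu => ?_, hR.entropy⟩
      · rw [hin g (hnode g hg)]
        exact hR.coding g hg
      · have hu' := Finset.ne_of_mem_erase hu
        rw [hin u hu', hout]
        by_cases hut : u = t
        · rw [hut, hdemt, hunion]
          refine (hR.decoding t ht).union hH ?_
          rw [h]
          exact hR.decoding t' ht'
        · rw [hdem u hut]
          exact hR.decoding u (Finset.mem_of_mem_erase hu)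
    · have h1 := hR.decoding t (Finset.mem_erase.2 ⟨hne, ht⟩)
      rw [hin t hne, hout, hdemt, hunion] at h1
      refine ⟨hR.indep, fun g hg => ?_, hR.rate, fun u hu => ?_, hR.entropy⟩
      · rw [← hin g (hnode g hg)]
        exact hR.coding g hg
      · by_cases hut : u = t
        · rw [hut]
          exact h1.anti_right hH Finset.subset_union_left
        · by_cases hut' : u = t'
          · rw [hut', ← h]
            exact h1.anti_right hH Finset.subset_union_right
          · rw [← hin u hut', ← hdem u hut]
            exact hR.decoding u (Finset.mem_erase.2 ⟨hut', hu⟩)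

theorem IsNetwork.refines_mergeNodes {A : Network V E} (hA : A.IsNetwork) {k j : V}
    (hk : k ∈ A.nodes) (hj : j ∈ A.nodes) (hkj : k ≠ j) (h : A.inEdges k = A.inEdges j) :
    A.Refines (A.mergeNodes k j) := by
  refine ⟨hA.isNetwork_mergeNodes hk hj hkj h, ?_⟩
  have hsource : ∀ s ∈ A.sources, k ≠ s ∧ j ≠ s := fun s hs =>
    ⟨fun h => Finset.disjoint_left.1 hA.disjoint_sources_nodes hs (h ▸ hk),
      fun h => Finset.disjoint_left.1 hA.disjoint_sources_nodes hs (h ▸ hj)⟩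
  have hin : ∀ v, v ≠ j → (A.mergeNodes k j).inEdges v = A.inEdges v := fun v hv =>
    inEdges_eq_of_head_erase A _ hv rfl fun _ => rfl
  have hout : ∀ v, v ≠ k → v ≠ j → (A.mergeNodes k j).outEdges v = A.outEdges v := by
    intro v hvk hvj
    ext e
    simp only [mem_outEdges, mergeNodes]
    split_ifs with hj'
    · simp [hvk.symm, hj', hvj.symm]
    · rfl
  have houtk : (A.mergeNodes k j).outEdges k = A.outEdges k ∪ A.outEdges j := by
    ext e
    simp only [Finset.mem_union, mem_outEdges, mergeNodes]
    split_ifs with hj'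
    · simp [hj', hkj.symm]
    · simp [hj']
  have hmem : ∀ D ⊆ A.sources, ∀ e, (A.mergeNodes k j).tail e ∈ D ↔ A.tail e ∈ D := by
    intro D hD e
    simp only [mergeNodes]
    split_ifs with hj'
    · rw [hj']
      exact ⟨fun h' => absurd rfl (hsource _ (hD h')).1, fun h' => absurd rfl (hsource _ (hD h')).2⟩
    · rfl
  have houtOf : ∀ D ⊆ A.sources, (A.mergeNodes k j).outEdgesOf D = A.outEdgesOf D := by
    intro D hD
    ext e
    rw [mem_outEdgesOf, mem_outEdgesOf, hmem D hD]
    rfl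
  have hsum : ∀ H : Finset E → ℝ, ∑ s ∈ A.sources, H ((A.mergeNodes k j).outEdges s) =
      ∑ s ∈ A.sources, H (A.outEdges s) := fun H => Finset.sum_congr rfl fun s hs => by
    rw [hout s (hsource s hs).1.symm (hsource s hs).2.symm]
  have hsink : ∀ t ∈ A.sinks, t ≠ j := fun t ht h' =>
    Finset.disjoint_left.1 hA.disjoint_nodes_sinks hj (h' ▸ ht)
  refine simulates_of_realizes_iff fun H hH r ω => ⟨fun hR => ?_, fun hR => ?_⟩
  · refine ⟨?_, fun g hg => ?_, fun e he hs => ?_, fun t ht => ?_, fun s hs => ?_⟩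
    · exact (congrArg H (houtOf _ subset_rfl)).trans (hR.indep.trans (hsum H).symm)
    · obtain ⟨hgj, hg⟩ := Finset.mem_erase.1 hg
      rw [hin g hgj]
      by_cases hgk : g = k
      · rw [hgk, houtk]
        refine (hR.coding k hk).union hH ?_
        rw [h]
        exact hR.coding j hj
      · rw [hout g hgk hgj]
        exact hR.coding g hg
    · exact hR.rate e he fun hs' => hs ((hmem _ subset_rfl e).2 hs')
    · rw [hin t (hsink t ht)]
      exact (congrArg (Determines H (A.inEdges t)) (houtOf _ (hA.demand_subset t ht))).mpr
        (hR.decoding t ht)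
    · rw [hout s (hsource s hs).1.symm (hsource s hs).2.symm]
      exact hR.entropy s hs
  · have h1 := hR.coding k (Finset.mem_erase.2 ⟨hkj, hk⟩)
    rw [hin k hkj, houtk] at h1
    refine ⟨?_, fun g hg => ?_, fun e he hs => ?_, fun t ht => ?_, fun s hs => ?_⟩
    · exact (congrArg H (houtOf _ subset_rfl)).symm.trans (hR.indep.trans (hsum H))
    · by_cases hgk : g = k
      · rw [hgk]
        exact h1.anti_right hH Finset.subset_union_left
      · by_cases hgj : g = j
        · rw [hgj, ← h]
          exact h1.anti_right hH Finset.subset_union_right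
        · rw [← hin g hgj, ← hout g hgk hgj]
          exact hR.coding g (Finset.mem_erase.2 ⟨hgj, hg⟩)
    · exact hR.rate e he fun hs' => hs ((hmem _ subset_rfl e).1 hs')
    · rw [← hin t (hsink t ht), ← houtOf _ (hA.demand_subset t ht)]
      exact hR.decoding t ht
    · rw [← hout s (hsource s hs).1.symm (hsource s hs).2.symm]
      exact hR.entropy s hs

/-- The sink `t'` can decode the source `s` like `t` does, from inputs that it keeps. -/
theorem IsNetwork.refines_dropAccess {A : Network V E} (hA : A.IsNetwork) {s t t' : V}
    (ht : t ∈ A.sinks) (ht' : t' ∈ A.sinks) (h : A.inEdges t ⊆ A.inEdges t')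
    (hs : s ∈ A.demand t) (hst : t' ∈ A.succs s) (hcond : A.MinCond 2) :
    A.Refines (A.dropAccess s t') := by
  have hsA := hA.demand_subset t ht hs
  have htt : t ≠ t' := by
    rintro rfl
    exact hcond s hsA t ht hst hs
  have hhead : ∀ e, (A.dropAccess s t').head e ⊆ A.head e := by
    intro e
    simp only [dropAccess]
    split_ifs
    · exact Finset.erase_subset _ _
    · exact subset_rfl
  have hin : ∀ v, v ≠ t' → (A.dropAccess s t').inEdges v = A.inEdges v := by
    intro v hv
    ext e
    simp only [mem_inEdges, dropAccess]
    split_ifs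
    · rw [Finset.mem_erase, and_iff_right hv]
    · rfl
  have hin' : (A.dropAccess s t').inEdges t' = A.inEdges t' \ A.outEdges s := by
    ext e
    simp only [mem_inEdges, mem_outEdges, Finset.mem_sdiff, dropAccess]
    split_ifs with hes
    · simp +contextual [hes]
    · simp [hes]
  -- By condition 2, the hyperedge of `s` is not an input of `t`.
  have hsub : A.inEdges t ⊆ A.inEdges t' \ A.outEdges s := by
    intro e he
    refine Finset.mem_sdiff.2 ⟨h he, fun he' => hcond s hsA t ht ?_ hs⟩
    exact Finset.mem_biUnion.2 ⟨e, he', (A.mem_inEdges.1 he).2⟩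
  have hnode : ∀ g ∈ A.nodes, g ≠ t' := by
    rintro g hg rfl
    exact Finset.disjoint_left.1 hA.disjoint_nodes_sinks hg ht'
  constructor
  · exact hA.of_le subset_rfl subset_rfl subset_rfl rfl subset_rfl (fun e _ => hhead e)
      (fun e he => (hhead e).trans (hA.head_subset e he)) hA.tail_mem (fun _ h _ => h)
      hA.demand_subset
  · refine simulates_of_realizes_iff fun H hH r ω => ⟨fun hR => ?_, fun hR => ?_⟩
    · refine ⟨hR.indep, fun g hg => ?_, hR.rate, fun u hu => ?_, hR.entropy⟩
      · rw [hin g (hnode g hg)]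
        exact hR.coding g hg
      · by_cases hut : u = t'
        · rw [hut, hin']
          have h1 : Determines H (A.inEdges t' \ A.outEdges s) (A.outEdges s) := by
            refine ((hR.decoding t ht).mono_left hH hsub).anti_right hH fun e he => ?_
            rw [mem_outEdges] at he
            exact A.mem_outEdgesOf.2 ⟨he.1, he.2 ▸ hs⟩
          refine Determines.trans hH (Y := A.inEdges t') ?_ (hR.decoding t' ht')
          refine (h1.union hH (Determines.of_subset subset_rfl)).anti_right hH ?_
          rw [Finset.union_sdiff_self_eq_union]
          exact Finset.subset_union_right
        · rw [hin u hut]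
          exact hR.decoding u hu
    · refine ⟨hR.indep, fun g hg => ?_, hR.rate, fun u hu => ?_, hR.entropy⟩
      · rw [← hin g (hnode g hg)]
        exact hR.coding g hg
      · have h1 := hR.decoding u hu
        by_cases hut : u = t'
        · rw [hut, hin'] at h1
          rw [hut]
          exact h1.mono_left hH Finset.sdiff_subset
        · rwa [hin u hut] at h1

/-! ### Contractions -/

/-- The network `B` arises from `A` by removing the hyperedge `e`, which starts in an intermediate
node, while all inputs of the tail of `e` become inputs of the heads of `e`; the tail of `e` may
disappear if `e` is its only output.  For a realization of `B`, let `e` carry all inputs of its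
tail, at the rate that this requires. -/
theorem IsNetwork.simulates_of_contract {A B : Network V E} (hA : A.IsNetwork) {e : E}
    (he : e ∈ A.edges) (hnode : A.tail e ∈ A.nodes) (hsources : B.sources = A.sources)
    (hsinks : B.sinks = A.sinks) (hdemand : B.demand = A.demand) (htail : B.tail = A.tail)
    (hedges : B.edges = A.edges.erase e) (hnodes : B.nodes ⊆ A.nodes)
    (hgone : ∀ g ∈ A.nodes, g ∉ B.nodes → A.outEdges g = {e})
    (hin : ∀ v ∈ B.nodes ∪ B.sinks, B.inEdges v =
      (A.inEdges v).erase e ∪ if e ∈ A.inEdges v then A.inEdges (A.tail e) else ∅) :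
    A.Simulates B := by
  have hs : A.tail e ∉ A.sources := Finset.disjoint_right.1 hA.disjoint_sources_nodes hnode
  have hloop : e ∉ A.inEdges (A.tail e) := fun h =>
    hA.acyclic _ (Relation.TransGen.single ⟨e, he, rfl, (A.mem_inEdges.1 h).2⟩)
  have hout : ∀ v, B.outEdges v = (A.outEdges v).erase e := by
    intro v
    ext e'
    rw [mem_outEdges, Finset.mem_erase, mem_outEdges, hedges, htail, Finset.mem_erase]
    exact and_assoc
  have hout' : ∀ v, v ≠ A.tail e → B.outEdges v = A.outEdges v := by
    intro v hv
    rw [hout, Finset.erase_eq_of_notMem]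
    exact fun h => hv (A.mem_outEdges.1 h).2.symm
  have hnotMem : ∀ D ⊆ A.sources, e ∉ A.outEdgesOf D := fun D hD h =>
    hs (hD (A.mem_outEdgesOf.1 h).2)
  have houtOf : ∀ D ⊆ A.sources, B.outEdgesOf D = A.outEdgesOf D := by
    intro D hD
    rw [← Finset.erase_eq_of_notMem (hnotMem D hD)]
    ext e'
    rw [mem_outEdgesOf, Finset.mem_erase, mem_outEdgesOf, hedges, htail, Finset.mem_erase]
    exact and_assoc
  have hsum : ∀ H : Finset E → ℝ, ∑ s ∈ A.sources, H (B.outEdges s) =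
      ∑ s ∈ A.sources, H (A.outEdges s) := fun H => Finset.sum_congr rfl fun s hs' => by
    rw [hout' s fun h => hs (h ▸ hs')]
  intro H hH r ω h
  set Z := A.inEdges (A.tail e) with hZ
  let φ : E → Finset E := Function.update (fun e' => {e'}) e Z
  have hφ : φ e = Z := Function.update_self _ _ _
  have hφ' : ∀ e', e' ≠ e → φ e' = {e'} := fun e' h' => Function.update_of_ne h' _ _
  have hpull : ∀ X, pullback φ H X = H (X.erase e ∪ if e ∈ X then Z else ∅) := by
    intro X
    rw [pullback]
    congr 1
    ext e'
    simp only [Finset.mem_biUnion, Finset.mem_union, Finset.mem_erase]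
    constructor
    · rintro ⟨e'', he'', h'⟩
      by_cases hee : e'' = e
      · rw [hee, hφ] at h'
        rw [hee] at he''
        rw [if_pos he'']
        exact Or.inr h'
      · rw [hφ' e'' hee, Finset.mem_singleton] at h'
        rw [h']
        exact Or.inl ⟨hee, he''⟩
    · rintro (⟨hne, he'⟩ | h')
      · exact ⟨e', he', by rw [hφ' e' hne, Finset.mem_singleton]⟩
      · split_ifs at h' with heX
        · exact ⟨e, heX, by rwa [hφ]⟩
        · simp at h'
  have hpull' : ∀ X, e ∉ X → pullback φ H X = H X := by
    intro X hX
    rw [hpull, if_neg hX, Finset.erase_eq_of_notMem hX, Finset.union_empty]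
  have houte : ∀ v, v ≠ A.tail e → e ∉ A.outEdges v := fun v hv h' =>
    hv (A.mem_outEdges.1 h').2.symm
  -- The realization `pullback φ H` turns inputs in `A` into inputs in `B`.
  have hdet : ∀ v ∈ B.nodes ∪ B.sinks, ∀ X, e ∉ X → Determines H (B.inEdges v) X →
      Determines (pullback φ H) (A.inEdges v) X := by
    intro v hv X hX h'
    have h1 : pullback φ H (X ∪ A.inEdges v) = H (X ∪ B.inEdges v) := by
      rw [hpull, hin v hv, Finset.erase_union_distrib, Finset.erase_eq_of_notMem hX,
        Finset.union_assoc]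
      simp only [Finset.mem_union, hX, false_or]
    rw [Determines, h1, hpull, ← hin v hv]
    exact h'
  refine ⟨φ, Function.update r e (H Z), ω, ?_, fun H' hH' h' => ?_⟩
  · refine ⟨?_, fun g hg => ?_, fun e' he' hs' => ?_, fun t ht => ?_, fun s hs' => ?_⟩
    · rw [hpull' _ (hnotMem _ subset_rfl), ← houtOf _ subset_rfl, ← hsources, h.indep, hsources]
      refine Finset.sum_congr rfl fun s hs' => ?_
      have hse : s ≠ A.tail e := fun h => hs (h ▸ hs')
      rw [hpull' _ (houte s hse), hout' s hse]
    · have hP := pullback_mem_shannonCone φ hH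
      have h1 : Determines (pullback φ H) (A.inEdges g) ((A.outEdges g).erase e) := by
        by_cases hgB : g ∈ B.nodes
        · refine hdet g (Finset.mem_union_left _ hgB) _ (Finset.notMem_erase _ _) ?_
          rw [← hout]
          exact h.coding g hgB
        · rw [hgone g hg hgB, Finset.erase_singleton]
          exact Determines.of_subset (Finset.empty_subset _)
      by_cases hge : g = A.tail e
      · have h2 : Determines (pullback φ H) Z {e} := by
          rw [Determines, hpull, hpull' _ hloop, if_pos (by simp)]
          congr 1
          rw [Finset.erase_union_distrib, Finset.erase_singleton, Finset.empty_union,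
            Finset.erase_eq_of_notMem hloop, Finset.union_self]
        refine (h1.union hP (X' := {e}) (hge ▸ h2)).anti_right hP fun e' he' => ?_
        by_cases hee : e' = e
        · simp [hee]
        · simp [hee, he']
      · rwa [Finset.erase_eq_of_notMem (houte g hge)] at h1
    · by_cases hee : e' = e
      · rw [hee, Function.update_self, hpull]
        simp
      · rw [Function.update_of_ne hee, hpull' _ (by simpa using Ne.symm hee)]
        exact h.rate e' (by rw [hedges]; exact Finset.mem_erase.2 ⟨hee, he'⟩)
          (by rwa [htail, hsources])
    · have hsub := hA.demand_subset t ht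
      rw [← hsinks] at ht
      refine hdet t (Finset.mem_union_right _ ht) _ (hnotMem _ hsub) ?_
      rw [← houtOf _ hsub, ← hdemand]
      exact h.decoding t ht
    · have hse : s ≠ A.tail e := fun h => hs (h ▸ hs')
      rw [hpull' _ (houte s hse), ← hout' s hse]
      exact h.entropy s (by rwa [hsources])
  · have hdet' : ∀ v ∈ B.nodes ∪ B.sinks, Determines H' (B.inEdges v) (A.inEdges v) := by
      intro v hv
      refine Determines.of_forall hH' fun e' he' => ?_
      rw [hin v hv]
      by_cases hee : e' = e
      · rw [hee] at he' ⊢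
        rw [if_pos he']
        refine ((h'.coding _ hnode).anti_right hH' ?_).mono_left hH' Finset.subset_union_right
        exact Finset.singleton_subset_iff.2 (A.mem_outEdges.2 ⟨he, rfl⟩)
      · refine Determines.of_subset (Finset.singleton_subset_iff.2 ?_)
        exact Finset.mem_union_left _ (Finset.mem_erase.2 ⟨hee, he'⟩)
    refine ⟨?_, fun g hg => ?_, fun e' he' hs' => ?_, fun t ht => ?_, fun s hs' => ?_⟩
    · rw [hsources, hsum, houtOf _ subset_rfl, h'.indep]
    · rw [hout]
      exact ((hdet' g (Finset.mem_union_left _ hg)).trans hH'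
        (h'.coding g (hnodes hg))).anti_right hH' (Finset.erase_subset _ _)
    · rw [hedges, Finset.mem_erase] at he'
      have h1 := h'.rate e' he'.2 (by rwa [← htail, ← hsources])
      rwa [Function.update_of_ne he'.1] at h1
    · rw [hdemand, houtOf _ (hA.demand_subset t (hsinks ▸ ht))]
      exact (hdet' t (Finset.mem_union_right _ ht)).trans hH' (h'.decoding t (hsinks ▸ ht))
    · rw [hsources] at hs'
      rw [hout' s fun h => hs (h ▸ hs')]
      exact h'.entropy s hs'

theorem IsNetwork.refines_contractEdge {A : Network V E} (hA : A.IsNetwork) {e : E}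
    (he : e ∈ A.edges) (hs : A.tail e ∉ A.sources) : A.Refines (A.contractEdge e) := by
  have hnode : A.tail e ∈ A.nodes :=
    (Finset.mem_union.1 (hA.tail_mem e he)).resolve_left hs
  constructor
  · refine ⟨hA.disjoint_sources_nodes, hA.disjoint_sources_sinks, hA.disjoint_nodes_sinks,
      fun e' he' => hA.tail_mem e' (Finset.mem_of_mem_erase he'), fun e' he' => ?_, fun s hs' => ?_,
      hA.demand_subset, acyclic_of_step hA.acyclic ?_⟩
    · have h1 := hA.head_subset e' (Finset.mem_of_mem_erase he')
      simp only [contractEdge]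
      split_ifs
      · exact Finset.union_subset h1 (hA.head_subset e he)
      · exact h1
    · obtain ⟨e', ⟨he', hte'⟩, huniq⟩ := hA.source_edge s hs'
      refine ⟨e', ⟨Finset.mem_erase.2 ⟨?_, he'⟩, hte'⟩, fun e'' he'' =>
        huniq e'' ⟨Finset.mem_of_mem_erase he''.1, he''.2⟩⟩
      rintro rfl
      exact hs (hte' ▸ hs')
    · rintro u v ⟨e', he', rfl, hv⟩
      have he' := Finset.mem_of_mem_erase he'
      simp only [contractEdge] at hv ⊢
      split_ifs at hv with h1
      · rcases Finset.mem_union.1 hv with hv | hv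
        · exact Relation.TransGen.single ⟨e', he', rfl, hv⟩
        · exact (Relation.TransGen.single ⟨e', he', rfl, h1⟩).tail ⟨e, he, rfl, hv⟩
      · exact Relation.TransGen.single ⟨e', he', rfl, hv⟩
  · refine hA.simulates_of_contract he hnode rfl rfl rfl rfl rfl subset_rfl
      (fun _ h h' => absurd h h') fun v _ => ?_
    have hloop : A.tail e ∉ A.head e := fun h =>
      hA.acyclic _ (Relation.TransGen.single ⟨e, he, rfl, h⟩)
    ext e'
    simp only [Finset.mem_union, Finset.mem_erase, mem_ite_empty, mem_inEdges, contractEdge]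
    by_cases ht : A.tail e ∈ A.head e'
    · have hee : e' ≠ e := by
        rintro rfl
        exact hloop ht
      rw [if_pos ht, Finset.mem_union]
      tauto
    · rw [if_neg ht]
      tauto

theorem IsNetwork.refines_bypassNode {A : Network V E} (hA : A.IsNetwork) {e e' : E} {g : V}
    (hg : g ∈ A.nodes) (hin : A.inEdges g = {e}) (hh : A.head e = {g})
    (hout : A.outEdges g = {e'}) : A.Refines (A.bypassNode g e e') := by
  have hmem_in : ∀ e'', (e'' ∈ A.edges ∧ g ∈ A.head e'') ↔ e'' = e := by
    intro e''
    rw [← mem_inEdges, hin, Finset.mem_singleton]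
  have hmem_out : ∀ e'', (e'' ∈ A.edges ∧ A.tail e'' = g) ↔ e'' = e' := by
    intro e''
    rw [← mem_outEdges, hout, Finset.mem_singleton]
  have he : e ∈ A.edges := ((hmem_in e).2 rfl).1
  obtain ⟨he', ht'⟩ := (hmem_out e').2 rfl
  have hloop : g ∉ A.head e' := fun h =>
    hA.acyclic _ (Relation.TransGen.single ⟨e', he', ht', h⟩)
  have hne : e ≠ e' := by
    rintro rfl
    exact hloop (hh ▸ Finset.mem_singleton_self g)
  have hgs : g ∉ A.sources := Finset.disjoint_right.1 hA.disjoint_sources_nodes hg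
  have hgt : g ∉ A.sinks := Finset.disjoint_left.1 hA.disjoint_nodes_sinks hg
  have hhead : (A.bypassNode g e e').head e = A.head e' := Function.update_self _ _ _
  have hhead' : ∀ e'', e'' ≠ e → (A.bypassNode g e e').head e'' = A.head e'' := fun e'' h =>
    Function.update_of_ne h _ _
  constructor
  · refine ⟨hA.disjoint_sources_nodes.mono_right (Finset.erase_subset _ _),
      hA.disjoint_sources_sinks, hA.disjoint_nodes_sinks.mono_left (Finset.erase_subset _ _),
      fun e'' he'' => ?_, fun e'' he'' v hv => ?_, fun s hs => ?_, hA.demand_subset,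
      acyclic_of_step hA.acyclic ?_⟩
    · obtain ⟨hee, he''⟩ := Finset.mem_erase.1 he''
      have h1 := hA.tail_mem e'' he''
      have h2 : A.tail e'' ≠ g := fun h => hee ((hmem_out e'').1 ⟨he'', h⟩)
      simp only [bypassNode, Finset.mem_union, Finset.mem_erase] at h1 ⊢
      tauto
    · obtain ⟨hee, he''⟩ := Finset.mem_erase.1 he''
      have h1 : v ∈ A.nodes ∪ A.sinks ∧ v ≠ g := by
        by_cases hee' : e'' = e
        · rw [hee', hhead] at hv
          exact ⟨hA.head_subset e' he' hv, fun h => hloop (h ▸ hv)⟩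
        · rw [hhead' e'' hee'] at hv
          exact ⟨hA.head_subset e'' he'' hv, fun h => hee' ((hmem_in e'').1 ⟨he'', h ▸ hv⟩)⟩
      simp only [bypassNode, Finset.mem_union, Finset.mem_erase] at h1 ⊢
      tauto
    · obtain ⟨a, ⟨ha, hta⟩, huniq⟩ := hA.source_edge s hs
      refine ⟨a, ⟨Finset.mem_erase.2 ⟨?_, ha⟩, hta⟩, fun b hb =>
        huniq b ⟨Finset.mem_of_mem_erase hb.1, hb.2⟩⟩
      rintro rfl
      exact hgs (ht'.symm.trans hta ▸ hs)
    · rintro u v ⟨a, ha, rfl, hv⟩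
      have ha := Finset.mem_of_mem_erase ha
      by_cases hae : a = e
      · rw [hae, hhead] at hv
        rw [hae]
        exact (Relation.TransGen.single
          ⟨e, he, rfl, hh ▸ Finset.mem_singleton_self g⟩).tail ⟨e', he', ht', hv⟩
      · rw [hhead' a hae] at hv
        exact Relation.TransGen.single ⟨a, ha, rfl, hv⟩
  · refine hA.simulates_of_contract he' (ht'.symm ▸ hg) rfl rfl rfl rfl rfl
      (Finset.erase_subset _ _) (fun v hv hv' => ?_) fun v hv => ?_
    · have : v = g := by
        by_contra h
        exact hv' (Finset.mem_erase.2 ⟨h, hv⟩)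
      rw [this, hout]
    · have hvg : v ≠ g := by
        rintro rfl
        simp [bypassNode, hgt] at hv
      rw [ht', hin]
      ext a
      have hedge : a ∈ (A.bypassNode g e e').edges ↔ a ≠ e' ∧ a ∈ A.edges := Finset.mem_erase
      simp only [Finset.mem_union, Finset.mem_erase, mem_ite_empty, mem_inEdges, hedge,
        Finset.mem_singleton]
      by_cases hae : a = e
      · rw [hae, hhead, hh, Finset.mem_singleton]
        tauto
      · rw [hhead' a hae]
        tauto

/-! ### Minors -/

theorem IsNetwork.refines_of_reductionStep {A B : Network V E} (hA : A.IsNetwork)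
    (h : A.ReductionStep B) : A.Refines B := by
  obtain ⟨k, hk, h⟩ := h
  cases h with
  | emptyDemand t ht h => exact hA.refines_deleteSink_of_demand_eq_empty ht h
  | uselessSource s hs h => exact hA.refines_deleteSources {s}
  | directDemand s t hs ht hst hd =>
    refine hA.refines_dropDemand ht fun H _ _ _ _ => Determines.of_subset ?_
    rw [outEdgesOf_singleton]
    exact hA.outEdges_subset_inEdges hs hst
  | uselessNode g hg h => exact hA.refines_deleteNode hg
  | uselessSink t ht h => exact hA.refines_deleteSink ht
  | equalNodes k j hk' hj hkj h => exact hA.refines_mergeNodes hk' hj hkj h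
  | undemanded s hs h => exact hA.refines_deleteSources {s}
  | equalSources s s' hs hs' hne h hd => exact hA.refines_deleteSources {s'}
  | emptyHead e he h =>
    -- By condition 1, a hyperedge without heads does not leave a source.
    refine hA.refines_deleteEdge fun hs => ?_
    obtain ⟨v, hv⟩ := hk 1 (by norm_num) _ hs
    have h1 := hA.outEdges_subset_inEdges hs (Finset.mem_inter.1 hv).1
      (A.mem_outEdges.2 ⟨he, rfl⟩)
    rw [mem_inEdges, h] at h1
    exact Finset.notMem_empty v h1.2
  | parallelEdges e e' he he' hne ht hh =>
    -- A source has only one hyperedge, so parallel hyperedges do not leave a source.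
    exact hA.refines_deleteEdge fun hs => hne
      ((hA.source_edge _ hs).unique ⟨he, ht⟩ ⟨he', rfl⟩)
  | relayNode e e' g he he' hg hin hh hout => exact hA.refines_bypassNode hg hin hh hout
  | unreachable s t ht hd h => exact hA.refines_deleteSources {s}
  | equalSinks t t' ht ht' hne h => exact hA.refines_mergeSinks ht ht' hne h
  | impliedDemand t t' ht ht' hne h hd =>
    refine hA.refines_dropDemand ht' fun H hH r ω hR => ?_
    have h1 := hR.decoding t ht
    have h2 : (A.dropDemand t' (A.demand t ∩ A.demand t')).demand t = A.demand t :=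
      Function.update_of_ne hne _ _
    rw [h2] at h1
    refine (Determines.mono_left hH h1 h).anti_right hH fun e he => ?_
    rw [mem_outEdgesOf, Finset.mem_inter] at he
    exact A.mem_outEdgesOf.2 ⟨he.1, he.2.1⟩
  | impliedAccess s t t' ht ht' h hs hst =>
    exact hA.refines_dropAccess ht ht' h hs hst (hk 2 (by norm_num))
  | disconnected v hv h => exact hA.refines_component v (hk 10 (by norm_num))

theorem IsNetwork.refines_of_isMinimalForm {A B : Network V E} (hA : A.IsNetwork)
    (h : IsMinimalForm A B) : A.Refines B := by
  obtain ⟨h, -⟩ := h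
  induction h with
  | refl => exact ⟨hA, Simulates.refl A⟩
  | tail _ h ih => exact ih.trans (ih.isNetwork.refines_of_reductionStep h)

theorem IsNetwork.refines_of_minorStep {A B : Network V E} (hA : A.IsNetwork)
    (h : MinorStep A B) : A.Refines B := by
  cases h with
  | deleteSource s hs h =>
    have h1 := hA.refines_deleteSources {s}
    exact h1.trans (h1.isNetwork.refines_of_isMinimalForm h)
  | deleteEdge e he hs h =>
    have h1 := hA.refines_deleteEdge hs
    exact h1.trans (h1.isNetwork.refines_of_isMinimalForm h)
  | contractEdge e he hs h =>
    have h1 := hA.refines_contractEdge he hs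
    exact h1.trans (h1.isNetwork.refines_of_isMinimalForm h)

theorem IsNetwork.refines_of_isMinor {A A' : Network V E} (hA : A.IsNetwork)
    (h : IsMinor A' A) : A.Refines A' := by
  induction h with
  | refl => exact ⟨hA, Simulates.refl A⟩
  | tail _ h ih => exact ih.trans (ih.isNetwork.refines_of_minorStep h)

end Network

theorem corollary2 {V E : Type*} [DecidableEq V] [DecidableEq E]
    (F : Type*) [Field F] [Finite F]
    (A A' : Network V E) (hA : A.IsNetwork) (hminor : Network.IsMinor A' A) :
    ((A.VectorCodesSuffice F → A'.VectorCodesSuffice F) ∧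
      (A.ScalarCodesSuffice F → A'.ScalarCodesSuffice F) ∧
      (A.ShannonTight → A'.ShannonTight)) ∧
    ((¬ A'.VectorCodesSuffice F → ¬ A.VectorCodesSuffice F) ∧
      (¬ A'.ScalarCodesSuffice F → ¬ A.ScalarCodesSuffice F) ∧
      (¬ A'.ShannonTight → ¬ A.ShannonTight)) := by
  obtain ⟨h₁, h₂, h₃⟩ := (hA.refines_of_isMinor hminor).simulates.inherit F
  exact ⟨⟨h₁, h₂, h₃⟩, mt h₁, mt h₂, mt h₃⟩
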